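/- For Boolean functions $f,g:\mathbb{F}_2^n\to\{-1,1\}$ let $$\delta_{\mathcal L}(f,g)=\min_{M\in \mathrm{GL}_n(\mathbb{F}_2)}\Pr_{x\in\mathbb{F}_2^n}[f(Mx)\ne g(x)].$$ For $h:\mathbb{F}_2^n\to\mathbb{R}$ let $\widehat h(\alpha)=2^{-n}\sum_x h(x)(-1)^{\langle\alpha,x\rangle}$, let $\|\widehat h\|_1=\sum_\alpha|\widehat h(\alpha)|$, and let $$\|\widehat f\|_{1,1/3}=\inf\{\|\widehat h\|_1 : h:\mathbb{F}_2^n\to\mathbb{R},\ |f(x)-h(x)|\le 1/3 \text{ for all } x\}.$$ Put $t(f,g)=\min\{\lceil\|\widehat f\|_{1,1/3}\rceil,\lceil\|\widehat g\|_{1,1/3}\rceil\}$. Alice is given $f$ and Bob is given $g$. A private-coin protocol is a two-party protocol in which each bit sent depends on the sender's input, the sender's own independent fair coins, and the bits sent so far. Its cost on $(f,g)$ is the number of bits exchanged on $(f,g)$, in the worst case over the coins. For $\omega>0$ it *decides whether $\delta_{\mathcal L}=0$ or $\delta_{\mathcal L}\ge\omega$* if, for all $f,g$, it outputs $1$ with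 probability at least $2/3$ when $\delta_{\mathcal L}(f,g)=0$, and outputs $0$ with probability at least $2/3$ when $\delta_{\mathcal L}(f,g)\ge\omega$. **(a)** There is an absolute constant $C>0$ such that for every $n$ and every $\omega>0$ there is a private-coin protocol that decides whether $\delta_{\mathcal L}=0$ or $\delta_{\mathcal L}\ge\omega$, and whose cost on every pair $(f,g)$ is at most $C\,t(f,g)^2/\omega^3$. **(b)** Every private-coin protocol that decides whether $\delta_{\mathcal L}=0$ or $\delta_{\mathcal L}\ge 1/20$ must communicate $\Omega(\log t)$ bits. Precisely: there is an absolute constant $c>0$ such that for all integers $n\ge 0$ and $T\ge 1$ with $T^2\le 2^n$, and for every such protocol on functions $\mathbb{F}_2^n\to\{-1,1\}$, there is a pair $(f,g)$ with $\delta_{\mathcal L}(f,g)=0$ or $\delta_{\mathcal L}(f,g)\ge 1/20$ and with $T^c\le t(f,g)\le T$, on which the cost of the protocol is at least $c\log T$ (so at least $c\log t(f,g)$). -/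

import Mathlib

open scoped Matrix MatrixGroups

noncomputable section

/-! Boolean functions on `𝔽₂ⁿ`, with values in `{-1, 1}` (the units of `ℤ`). -/

/-- The vector space `𝔽₂ⁿ`. -/
abbrev Cube (n : ℕ) : Type := Fin n → ZMod 2

/-- Boolean functions `𝔽₂ⁿ → {-1, 1}`. -/
abbrev BoolFun (n : ℕ) : Type := Cube n → ℤˣ

/-- A Boolean function regarded as a real-valued function. -/
def BoolFun.toReal {n : ℕ} (f : BoolFun n) : Cube n → ℝ := fun x => ((f x : ℤ) : ℝ)

/-- The distance `δ(f, g) = Pr_x [f x ≠ g x]`, for a uniformly random `x ∈ 𝔽₂ⁿ`. -/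
def hammingDelta {n : ℕ} (f g : BoolFun n) : ℝ :=
  ((Finset.univ.filter fun x : Cube n => f x ≠ g x).card : ℝ) / 2 ^ n

/-- The linear distance `δ_L(f, g) = min_M Pr_x [f (M x) ≠ g x]` over `M ∈ GL_n(𝔽₂)`
(the infimum ranges over a finite non-empty set, so it is a minimum). -/
def linearDist {n : ℕ} (f g : BoolFun n) : ℝ :=
  ⨅ M : GL (Fin n) (ZMod 2),
    hammingDelta (fun x => f ((M : Matrix (Fin n) (Fin n) (ZMod 2)) *ᵥ x)) g

/-! Fourier analysis on `𝔽₂ⁿ`. -/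

/-- The character `χ_α(x) = (-1)^⟨α, x⟩`. -/
def parityChar {n : ℕ} (α x : Cube n) : ℝ := (-1) ^ (α ⬝ᵥ x).val

/-- The Fourier coefficient `𝔼_x [h x · χ_α x]`. -/
def fourierCoeffCube {n : ℕ} (h : Cube n → ℝ) (α : Cube n) : ℝ :=
  (∑ x, h x * parityChar α x) / 2 ^ n

/-- The spectral norm: the sum of the absolute values of all Fourier coefficients. -/
def spectralNorm1 {n : ℕ} (h : Cube n → ℝ) : ℝ := ∑ α, |fourierCoeffCube h α|

/-- The `γ`-approximate spectral norm. -/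
def approxSpectralNorm {n : ℕ} (γ : ℝ) (h : Cube n → ℝ) : ℝ :=
  sInf {s : ℝ | ∃ h' : Cube n → ℝ, (∀ x, |h x - h' x| ≤ γ) ∧ s = spectralNorm1 h'}

/-- The parameter `t` of a pair of Boolean functions: the smaller of the two rounded-up
`1/3`-approximate spectral norms. -/
def specParam {n : ℕ} (f g : BoolFun n) : ℕ :=
  min ⌈approxSpectralNorm (1 / 3) f.toReal⌉₊ ⌈approxSpectralNorm (1 / 3) g.toReal⌉₊

/-! Two-party communication protocols. -/

/-- Deterministic two-party protocol trees. Alice holds an element of `X`, Bob one of `Y`.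
At each inner node the owner of the node sends one bit, which is a function of the owner's
input (and of the node, that is, of the bits sent so far), and the protocol moves on to the
corresponding child. A leaf carries the output. -/
inductive Protocol (X Y : Type) : Type
  | output (b : Bool) : Protocol X Y
  | alice (send : X → Bool) (next : Bool → Protocol X Y) : Protocol X Y
  | bob (send : Y → Bool) (next : Bool → Protocol X Y) : Protocol X Y

/-- The output of a protocol tree on a pair of inputs. -/
def Protocol.run {X Y : Type} : Protocol X Y → X → Y → Bool
  | .output b, _, _ => b
  | .alice send next, x, y => (next (send x)).run x y
  | .bob send next, x, y => (next (send y)).run x y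

/-- The number of bits exchanged by a protocol tree on a pair of inputs. -/
def Protocol.bits {X Y : Type} : Protocol X Y → X → Y → ℕ
  | .output _, _, _ => 0
  | .alice send next, x, y => (next (send x)).bits x y + 1
  | .bob send next, x, y => (next (send y)).bits x y + 1

/-- A private-coin randomized protocol. Alice and Bob toss `coinsA` and `coinsB` independent
fair coins; what a party sends depends on that party's input, that party's own coins, and
the bits sent so far. -/
structure PrivateCoinProtocol (X Y : Type) where
  coinsA : ℕ
  coinsB : ℕ
  tree : Protocol (X × (Fin coinsA → Bool)) (Y × (Fin coinsB → Bool))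

namespace PrivateCoinProtocol

/-- The pairs of coin strings of Alice and Bob. -/
abbrev Coins {X Y : Type} (P : PrivateCoinProtocol X Y) : Type :=
  (Fin P.coinsA → Bool) × (Fin P.coinsB → Bool)

/-- The probability, over uniformly random coins of both parties, of the output `b`. -/
def outputProb {X Y : Type} (P : PrivateCoinProtocol X Y) (x : X) (y : Y) (b : Bool) : ℝ :=
  ((Finset.univ.filter fun r : P.Coins => P.tree.run (x, r.1) (y, r.2) = b).card : ℝ) /
    Fintype.card P.Coins

/-- The number of bits exchanged on the inputs `x`, `y`, in the worst case over the coins. -/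
def cost {X Y : Type} (P : PrivateCoinProtocol X Y) (x : X) (y : Y) : ℕ :=
  Finset.univ.sup fun r : P.Coins => P.tree.bits (x, r.1) (y, r.2)

end PrivateCoinProtocol

/-- The protocol decides whether `δ_L(f, g) = 0` or `δ_L(f, g) ≥ ω`: on every pair of inputs
that satisfies one of the two, the answer is correct with probability at least `2/3`. -/
def DecidesLinIso {n : ℕ} (P : PrivateCoinProtocol (BoolFun n) (BoolFun n)) (ω : ℝ) : Prop :=
  ∀ f g : BoolFun n,
    (linearDist f g = 0 → 2 / 3 ≤ P.outputProb f g true) ∧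
    (ω ≤ linearDist f g → 2 / 3 ≤ P.outputProb f g false)

end

/-!
Upper bound. Let `h` be a `1/3`-approximation of `f` with `‖ĥ‖₁ ≤ 2t`. Dropping the Fourier
coefficients of `h` below `ω / (10 t)` keeps at most `20 t² / ω` of them and changes `h` little in
mean square (`sum_sq_sub_heavy_le`), so the sign of what is left agrees with `f` outside a fraction
`< ω / 2` of the cube: up to this error `f` is a function of `K ≈ 20 t² / ω` parities
(`exists_close_comp_linearMap`). Applying this to a canonical representative of the isomorphism
class of `f` gives a code of the class, one of `2 ^ 2 ^ (K + 1)` possible ones, such that functions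
with the same code are at linear distance `< ω` (`exists_code`). The parties find the smaller of
their spectral parameters by counting upwards, which takes `O(t)` bits, reject if the parameters
differ, and otherwise compare their codes by a polynomial fingerprint of `O(K)` bits
(`exists_levelwise_equality_protocol`). As `ω ≤ 1` may be assumed, `O(t² / ω)` is at most
`O(t² / ω³)`.

Lower bound. For `2 ^ k ≤ T < 2 ^ (k + 1)` take the bent functions `(x, y) ↦ (-1)^⟨x, y⟩ h(y)` of
`2k` of the coordinates. All their nonzero Fourier coefficients are `± 2⁻ᵏ`, hence their approximate
spectral norms lie between `(2/3) 2 ^ k` and `2 ^ k` (`le_specCeil_bentLift`,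
`specCeil_bentLift_le`). There are `2 ^ 2 ^ k` of them. A linear map of the whole cube acts on the
`2k` coordinates, after the others are fixed, through one of only `2 ^ (4k² + 2k)` affine maps
(`exists_affine_of_linearDist_lt`), and a Hamming ball of relative radius `1/10` contains at most
the square root of all `h` (`card_hammingBall_sq_le`); so a greedy choice leaves doubly
exponentially many members at pairwise linear distance `≥ 1/20` (`exists_far_bentLifts`). On these
a deciding protocol tests equality, and with private coins this costs `Ω(log log N)` bits on a set
of `N` elements (`PrivateCoinProtocol.exists_lt_cost`), that is, `Ω(k)`. For small `k` it is enough
that a protocol without communication has a constant output.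
-/

/-! ### Fourier analysis on the cube -/

theorem neg_one_pow_val_add {R : Type*} [Monoid R] [HasDistribNeg R] (a b : ZMod 2) :
    (-1 : R) ^ (a + b).val = (-1) ^ a.val * (-1) ^ b.val := by
  rw [ZMod.val_add, ← pow_add]
  conv_rhs => rw [← Nat.mod_add_div (a.val + b.val) 2, pow_add, pow_mul]
  simp

theorem parityChar_add_right {n : ℕ} (α x y : Cube n) :
    parityChar α (x + y) = parityChar α x * parityChar α y := by
  simp only [parityChar, dotProduct_add, neg_one_pow_val_add]

theorem parityChar_comm {n : ℕ} (α x : Cube n) : parityChar α x = parityChar x α := by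
  simp only [parityChar, dotProduct_comm]

theorem parityChar_add_left {n : ℕ} (α β x : Cube n) :
    parityChar (α + β) x = parityChar α x * parityChar β x := by
  simp only [parityChar, add_dotProduct, neg_one_pow_val_add]

theorem abs_parityChar {n : ℕ} (α x : Cube n) : |parityChar α x| = 1 := by
  simp [parityChar, abs_pow]

theorem cube_add_self {ι : Type*} (x : ι → ZMod 2) : x + x = 0 := by
  funext i; exact CharTwo.add_self_eq_zero (x i)

theorem exists_parityChar_eq_neg_one {n : ℕ} {α : Cube n} (h : α ≠ 0) :
    ∃ y, parityChar α y = -1 := by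
  obtain ⟨i, hi⟩ := Function.ne_iff.mp h
  refine ⟨Pi.single i 1, ?_⟩
  have h1 : α i = 1 := by
    generalize α i = a at hi
    fin_cases a
    · exact absurd rfl hi
    · rfl
  simp [parityChar, h1, ZMod.val_one]

theorem sum_parityChar {n : ℕ} (α : Cube n) :
    ∑ x, parityChar α x = if α = 0 then (2 : ℝ) ^ n else 0 := by
  split_ifs with h
  · subst h
    simp [parityChar, ZMod.card]
  · obtain ⟨y, hy⟩ := exists_parityChar_eq_neg_one h
    have := Equiv.sum_comp (Equiv.addRight y) (fun x => parityChar α x)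
    simp only [Equiv.coe_addRight, parityChar_add_right, hy, ← Finset.sum_mul] at this
    linarith

theorem sum_parityChar_mul {n : ℕ} (α β : Cube n) :
    ∑ x, parityChar α x * parityChar β x = if α = β then (2 : ℝ) ^ n else 0 := by
  simp only [← parityChar_add_left, sum_parityChar]
  congr 1
  rw [eq_iff_iff]
  constructor
  · intro h
    have := congrArg (· + β) h
    simpa [add_assoc, cube_add_self] using this
  · rintro rfl; exact cube_add_self α

/-- Fourier inversion. -/
theorem sum_fourierCoeffCube_mul_parityChar {n : ℕ} (h : Cube n → ℝ) (x : Cube n) :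
    ∑ α, fourierCoeffCube h α * parityChar α x = h x := by
  have h1 : ∀ α, fourierCoeffCube h α * parityChar α x =
      ∑ y, h y / 2 ^ n * (parityChar y α * parityChar x α) := by
    intro α
    rw [fourierCoeffCube, Finset.sum_div, Finset.sum_mul]
    refine Finset.sum_congr rfl fun y _ => ?_
    rw [parityChar_comm α x, parityChar_comm α y]
    ring
  simp only [h1]
  rw [Finset.sum_comm]
  simp only [← Finset.mul_sum, sum_parityChar_mul]
  simp

/-- Parseval's identity. -/
theorem sum_sq_sum_parityChar {n : ℕ} (c : Cube n → ℝ) :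
    ∑ x, (∑ α, c α * parityChar α x) ^ 2 = 2 ^ n * ∑ α, c α ^ 2 := by
  have h1 : ∀ x, (∑ α, c α * parityChar α x) ^ 2 =
      ∑ α, ∑ β, c α * c β * (parityChar α x * parityChar β x) := by
    intro x
    rw [sq, Finset.sum_mul_sum]
    refine Finset.sum_congr rfl fun α _ => Finset.sum_congr rfl fun β _ => by ring
  simp only [h1]
  rw [Finset.sum_comm, Finset.mul_sum]
  refine Finset.sum_congr rfl fun α _ => ?_
  rw [Finset.sum_comm]
  simp only [← Finset.mul_sum, sum_parityChar_mul]
  simp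
  ring

theorem abs_le_spectralNorm1 {n : ℕ} (h : Cube n → ℝ) (x : Cube n) : |h x| ≤ spectralNorm1 h := by
  rw [← sum_fourierCoeffCube_mul_parityChar h x, spectralNorm1]
  refine (Finset.abs_sum_le_sum_abs _ _).trans (Finset.sum_le_sum fun α _ => ?_)
  rw [abs_mul, abs_parityChar, mul_one]

theorem spectralNorm1_nonneg {n : ℕ} (h : Cube n → ℝ) : 0 ≤ spectralNorm1 h :=
  Finset.sum_nonneg fun _ _ => abs_nonneg _

/-! ### The approximate spectral norm -/

theorem toReal_eq {n : ℕ} (f : BoolFun n) (x : Cube n) :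
    (f x = 1 ∧ f.toReal x = 1) ∨ (f x = -1 ∧ f.toReal x = -1) := by
  rcases Int.units_eq_one_or (f x) with h | h <;> simp [BoolFun.toReal, h]

theorem approxSpectralNorm_le {n : ℕ} {γ : ℝ} (hγ : 0 ≤ γ) (h : Cube n → ℝ) :
    approxSpectralNorm γ h ≤ spectralNorm1 h := by
  refine csInf_le ⟨0, ?_⟩ ⟨h, fun x => by simpa using hγ, rfl⟩
  rintro s ⟨h', -, rfl⟩
  exact spectralNorm1_nonneg h'

theorem le_approxSpectralNorm {n : ℕ} {γ : ℝ} (hγ : 0 ≤ γ) {h : Cube n → ℝ} {b : ℝ}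
    (hb : ∀ h' : Cube n → ℝ, (∀ x, |h x - h' x| ≤ γ) → b ≤ spectralNorm1 h') :
    b ≤ approxSpectralNorm γ h := by
  refine le_csInf ⟨_, h, fun x => by simpa using hγ, rfl⟩ ?_
  rintro s ⟨h', h1, rfl⟩
  exact hb h' h1

theorem exists_spectralNorm1_lt {n : ℕ} {γ : ℝ} (hγ : 0 ≤ γ) {h : Cube n → ℝ} {b : ℝ}
    (hb : approxSpectralNorm γ h < b) :
    ∃ h' : Cube n → ℝ, (∀ x, |h x - h' x| ≤ γ) ∧ spectralNorm1 h' < b := by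
  by_contra! H
  exact hb.not_ge (le_approxSpectralNorm hγ H)

/-- The rounded-up `1/3`-approximate spectral norm of a single Boolean function. -/
noncomputable def specCeil {n : ℕ} (f : BoolFun n) : ℕ := ⌈approxSpectralNorm (1 / 3) f.toReal⌉₊

theorem specParam_eq_min {n : ℕ} (f g : BoolFun n) :
    specParam f g = min (specCeil f) (specCeil g) := rfl

theorem one_le_specCeil {n : ℕ} (f : BoolFun n) : 1 ≤ specCeil f := by
  refine Nat.one_le_ceil_iff.mpr (lt_of_lt_of_le (by norm_num : (0 : ℝ) < 2 / 3) ?_)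
  refine le_approxSpectralNorm (by norm_num) fun h' hh => ?_
  refine le_trans ?_ (abs_le_spectralNorm1 h' 0)
  have := abs_le.mp (hh 0)
  rcases toReal_eq f 0 with ⟨-, h⟩ | ⟨-, h⟩ <;> rw [h] at this
  · exact le_trans (by linarith) (le_abs_self _)
  · exact le_trans (by linarith) (neg_le_abs _)

/-! ### Hamming and linear distance -/

theorem hammingDelta_self {n : ℕ} (f : BoolFun n) : hammingDelta f f = 0 := by
  simp [hammingDelta]

theorem hammingDelta_nonneg {n : ℕ} (f g : BoolFun n) : 0 ≤ hammingDelta f g := by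
  unfold hammingDelta; positivity

theorem hammingDelta_comm {n : ℕ} (f g : BoolFun n) : hammingDelta f g = hammingDelta g f := by
  simp only [hammingDelta, ne_comm]

theorem hammingDelta_triangle {n : ℕ} (f g h : BoolFun n) :
    hammingDelta f h ≤ hammingDelta f g + hammingDelta g h := by
  unfold hammingDelta
  rw [← add_div]
  gcongr
  norm_cast
  refine le_trans (Finset.card_le_card ?_) (Finset.card_union_le _ _)
  intro x
  simp only [Finset.mem_filter, Finset.mem_univ, true_and, Finset.mem_union]
  intro h1
  by_contra! h2
  exact h1 (h2.1.trans h2.2)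

theorem hammingDelta_le_one {n : ℕ} (f g : BoolFun n) : hammingDelta f g ≤ 1 := by
  unfold hammingDelta
  rw [div_le_one (by positivity)]
  have := Finset.card_filter_le (Finset.univ : Finset (Cube n)) (fun x => f x ≠ g x)
  simp [ZMod.card] at this
  exact_mod_cast this

theorem eq_of_hammingDelta_eq_zero {n : ℕ} {f g : BoolFun n} (h : hammingDelta f g = 0) :
    f = g := by
  unfold hammingDelta at h
  rw [div_eq_zero_iff] at h
  rcases h with h | h
  · rw [Nat.cast_eq_zero, Finset.card_eq_zero, Finset.filter_eq_empty_iff] at h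
    funext x
    simpa using h (Finset.mem_univ x)
  · simp at h

theorem hammingDelta_comp_equiv {n : ℕ} (f g : BoolFun n) (e : Cube n ≃ Cube n) :
    hammingDelta (f ∘ e) (g ∘ e) = hammingDelta f g := by
  unfold hammingDelta
  congr 2
  refine Finset.card_equiv e fun x => by simp

/-- The linear automorphism of the cube given by an invertible matrix. -/
def glEquiv {n : ℕ} (M : GL (Fin n) (ZMod 2)) : Cube n ≃ₗ[ZMod 2] Cube n :=
  LinearMap.GeneralLinearGroup.generalLinearEquiv _ _ (Matrix.GeneralLinearGroup.toLin M)

theorem glEquiv_surjective {n : ℕ} (e : Cube n ≃ₗ[ZMod 2] Cube n) : ∃ M, glEquiv M = e := by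
  refine ⟨Matrix.GeneralLinearGroup.toLin.symm
    ((LinearMap.GeneralLinearGroup.generalLinearEquiv _ _).symm e), ?_⟩
  simp [glEquiv]

theorem linearDist_le {n : ℕ} (f g : BoolFun n) (e : Cube n ≃ₗ[ZMod 2] Cube n) :
    linearDist f g ≤ hammingDelta (f ∘ e) g := by
  obtain ⟨M, rfl⟩ := glEquiv_surjective e
  exact ciInf_le (Set.finite_range _).bddBelow M

theorem exists_linearDist_eq {n : ℕ} (f g : BoolFun n) :
    ∃ e : Cube n ≃ₗ[ZMod 2] Cube n, linearDist f g = hammingDelta (f ∘ e) g := by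
  obtain ⟨M, hM⟩ := exists_eq_ciInf_of_finite (f := fun M : GL (Fin n) (ZMod 2) =>
    hammingDelta (fun x => f ((M : Matrix (Fin n) (Fin n) (ZMod 2)) *ᵥ x)) g)
  exact ⟨glEquiv M, hM.symm⟩

theorem linearDist_le_hammingDelta {n : ℕ} (f g : BoolFun n)
    (e e' : Cube n ≃ₗ[ZMod 2] Cube n) : linearDist f g ≤ hammingDelta (f ∘ e) (g ∘ e') := by
  refine (linearDist_le f g (e'.symm.trans e)).trans_eq ?_
  rw [← hammingDelta_comp_equiv _ g e'.toEquiv]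
  congr 1
  funext x
  simp

theorem linearDist_comm {n : ℕ} (f g : BoolFun n) : linearDist f g = linearDist g f := by
  have key : ∀ f g : BoolFun n, linearDist f g ≤ linearDist g f := by
    intro f g
    obtain ⟨e, he⟩ := exists_linearDist_eq g f
    rw [he, hammingDelta_comm]
    exact linearDist_le_hammingDelta f g (LinearEquiv.refl _ _) e
  exact le_antisymm (key f g) (key g f)

theorem linearDist_le_one {n : ℕ} (f g : BoolFun n) : linearDist f g ≤ 1 :=
  (linearDist_le f g (LinearEquiv.refl _ _)).trans (hammingDelta_le_one _ _)

theorem linearDist_nonneg {n : ℕ} (f g : BoolFun n) : 0 ≤ linearDist f g := by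
  obtain ⟨e, he⟩ := exists_linearDist_eq f g
  exact he ▸ hammingDelta_nonneg _ _

theorem linearDist_self {n : ℕ} (f : BoolFun n) : linearDist f f = 0 :=
  le_antisymm ((linearDist_le f f (LinearEquiv.refl _ _)).trans_eq (hammingDelta_self f))
    (linearDist_nonneg f f)

theorem exists_comp_eq_of_linearDist_eq_zero {n : ℕ} {f g : BoolFun n} (h : linearDist f g = 0) :
    ∃ e : Cube n ≃ₗ[ZMod 2] Cube n, f ∘ e = g := by
  obtain ⟨e, he⟩ := exists_linearDist_eq f g
  exact ⟨e, eq_of_hammingDelta_eq_zero (he.symm.trans h)⟩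

/-! ### Approximation by functions of few parities -/

theorem card_heavy_mul_le {n : ℕ} (h : Cube n → ℝ) (θ : ℝ) :
    ((Finset.univ.filter fun α => θ ≤ |fourierCoeffCube h α|).card : ℝ) * θ ≤ spectralNorm1 h := by
  rw [← nsmul_eq_mul]
  refine (Finset.card_nsmul_le_sum _ (fun α => |fourierCoeffCube h α|) θ ?_).trans
    (Finset.sum_le_univ_sum_of_nonneg fun _ => abs_nonneg _)
  intro α hα
  exact (Finset.mem_filter.mp hα).2

/-- Truncating a function of small spectral norm to its large Fourier coefficients costs little in
mean square, since a coefficient `c` with `|c| < θ` has `c ^ 2 ≤ θ * |c|`. -/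
theorem sum_sq_sub_heavy_le {n : ℕ} (h : Cube n → ℝ) {θ : ℝ} (hθ : 0 ≤ θ) :
    ∑ x, (h x - ∑ α with θ ≤ |fourierCoeffCube h α|, fourierCoeffCube h α * parityChar α x) ^ 2 ≤
      2 ^ n * (θ * spectralNorm1 h) := by
  have h1 : ∀ x, h x - ∑ α with θ ≤ |fourierCoeffCube h α|,
      fourierCoeffCube h α * parityChar α x =
      ∑ α, (if θ ≤ |fourierCoeffCube h α| then 0 else fourierCoeffCube h α) * parityChar α x := by
    intro x
    rw [← sum_fourierCoeffCube_mul_parityChar h x, Finset.sum_filter, ← Finset.sum_sub_distrib]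
    refine Finset.sum_congr rfl fun α _ => ?_
    split_ifs <;> simp
  simp only [h1, sum_sq_sum_parityChar]
  gcongr
  rw [spectralNorm1, Finset.mul_sum]
  refine Finset.sum_le_sum fun α _ => ?_
  split_ifs with h2
  · simpa using mul_nonneg hθ (abs_nonneg _)
  · rw [← sq_abs, sq]
    exact mul_le_mul_of_nonneg_right (not_le.mp h2).le (abs_nonneg _)

/-- A Boolean function with approximate spectral norm at most `s` is `ω / 2`-close to a function
of `K` parities, as soon as `K ≥ 20 s² / ω`. -/
theorem exists_close_comp_linearMap {n : ℕ} (f : BoolFun n) {ω : ℝ} (hω : 0 < ω) {s K : ℕ}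
    (hs : specCeil f ≤ s) (hK : 20 * (s : ℝ) ^ 2 / ω ≤ K) :
    ∃ (φ : BoolFun K) (L : Cube n →ₗ[ZMod 2] Cube K), hammingDelta f (φ ∘ L) < ω / 2 := by
  have hs1 : (1 : ℝ) ≤ s := by exact_mod_cast (one_le_specCeil f).trans hs
  have hlt : approxSpectralNorm (1 / 3) f.toReal < 2 * s := by
    have h1 : approxSpectralNorm (1 / 3) f.toReal ≤ specCeil f := Nat.le_ceil _
    have h2 : (specCeil f : ℝ) ≤ s := by exact_mod_cast hs
    linarith
  obtain ⟨h, hfh, hB⟩ := exists_spectralNorm1_lt (by norm_num) hlt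
  set θ : ℝ := ω / (10 * s) with hθ
  have hθ0 : 0 < θ := by positivity
  set S := Finset.univ.filter fun α => θ ≤ |fourierCoeffCube h α| with hS
  set hS' : Cube n → ℝ := fun x => ∑ α ∈ S, fourierCoeffCube h α * parityChar α x with hhS
  have hcard : S.card ≤ K := by
    have h1 := card_heavy_mul_le h θ
    have h2 : (S.card : ℝ) ≤ 20 * (s : ℝ) ^ 2 / ω := by
      rw [le_div_iff₀ hω]
      have h3 : (S.card : ℝ) * θ ≤ 2 * s := h1.trans hB.le
      rw [hθ, mul_div_assoc', div_le_iff₀ (by positivity)] at h3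
      linarith
    exact_mod_cast h2.trans hK
  have hcard' : Fintype.card S ≤ Fintype.card (Fin K) := by simpa using hcard
  obtain ⟨e⟩ := Function.Embedding.nonempty_of_card_le hcard'
  let v : Fin K → Cube n := Function.extend e Subtype.val 0
  have hv : ∀ a : S, v (e a) = a := fun a => e.injective.extend_apply _ _ a
  let L : Cube n →ₗ[ZMod 2] Cube K := (Matrix.of v).mulVecLin
  have hL : ∀ (a : S) x, parityChar a.1 x = (-1) ^ (L x (e a)).val := by
    intro a x
    rw [parityChar, ← hv a]
    rfl
  let φ : BoolFun K := fun w =>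
    if 0 ≤ ∑ a : S, fourierCoeffCube h a * (-1 : ℝ) ^ (w (e a)).val then 1 else -1
  have hφ : ∀ x, φ (L x) = if 0 ≤ hS' x then 1 else -1 := by
    intro x
    have : hS' x = ∑ a : S, fourierCoeffCube h a * (-1 : ℝ) ^ (L x (e a)).val := by
      simp only [← hL]
      rw [hhS]
      exact (Finset.sum_coe_sort S fun α => fourierCoeffCube h α * parityChar α x).symm
    simp only [φ, this]
  refine ⟨φ, L, ?_⟩
  -- A disagreement at `x` forces the truncation to be `2 / 3` away from `h` there.
  have hpt : ∀ x, f x ≠ φ (L x) → 4 / 9 ≤ (h x - hS' x) ^ 2 := by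
    intro x hx
    have h1 := abs_le.mp (hfh x)
    rw [hφ] at hx
    rcases toReal_eq f x with ⟨h2, h3⟩ | ⟨h2, h3⟩ <;> rw [h3] at h1 <;> rw [h2] at hx <;>
      split_ifs at hx with h4
    · exact absurd rfl hx
    · nlinarith
    · nlinarith
    · exact absurd rfl hx
  have hsum : ((Finset.univ.filter fun x => f x ≠ (φ ∘ L) x).card : ℝ) * (4 / 9) ≤
      2 ^ n * (θ * spectralNorm1 h) := by
    refine le_trans ?_ (sum_sq_sub_heavy_le h hθ0.le)
    rw [← nsmul_eq_mul]
    refine (Finset.card_nsmul_le_sum _ (fun x => (h x - hS' x) ^ 2) _ ?_).trans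
      (Finset.sum_le_univ_sum_of_nonneg fun _ => sq_nonneg _)
    intro x hx
    exact hpt x (Finset.mem_filter.mp hx).2
  have hθB : θ * spectralNorm1 h < ω / 5 := by
    refine (mul_lt_mul_of_pos_left hB hθ0).trans_eq ?_
    rw [hθ]; field_simp; norm_num
  have h2n : (0 : ℝ) < 2 ^ n := by positivity
  rw [hammingDelta, div_lt_iff₀ h2n]
  have := mul_lt_mul_of_pos_left hθB h2n
  nlinarith

/-- Two linear maps with the same range differ by an automorphism of the source. -/
theorem exists_linearEquiv_comp_eq {F V W : Type*} [Field F] [AddCommGroup V] [Module F V]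
    [FiniteDimensional F V] [AddCommGroup W] [Module F W] (L L' : V →ₗ[F] W)
    (h : LinearMap.range L = LinearMap.range L') : ∃ e : V ≃ₗ[F] V, ∀ x, L' (e x) = L x := by
  obtain ⟨C, hC⟩ := (LinearMap.ker L).exists_isCompl
  obtain ⟨C', hC'⟩ := (LinearMap.ker L').exists_isCompl
  have hker : Module.finrank F (LinearMap.ker L) = Module.finrank F (LinearMap.ker L') := by
    have h1 := L.finrank_range_add_finrank_ker
    have h2 := L'.finrank_range_add_finrank_ker
    rw [h] at h1
    omega
  let k : LinearMap.ker L ≃ₗ[F] LinearMap.ker L' := LinearEquiv.ofFinrankEq _ _ hker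
  let a : C ≃ₗ[F] LinearMap.range L := L.kerComplementEquivRange hC.symm
  let a' : C' ≃ₗ[F] LinearMap.range L' := L'.kerComplementEquivRange hC'.symm
  let c : C ≃ₗ[F] C' := a.trans ((LinearEquiv.ofEq _ _ h).trans a'.symm)
  have hc : ∀ y : C, L' (c y) = L y := by
    intro y
    have h1 : a' (c y) = LinearEquiv.ofEq _ _ h (a y) := by simp [c]
    exact congrArg Subtype.val h1
  refine ⟨(Submodule.prodEquivOfIsCompl _ _ hC).symm.trans
    ((k.prodCongr c).trans (Submodule.prodEquivOfIsCompl _ _ hC')), fun x => ?_⟩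
  obtain ⟨⟨u, w⟩, rfl⟩ := (Submodule.prodEquivOfIsCompl _ _ hC).surjective x
  simp [hc, LinearMap.mem_ker.mp u.2, LinearMap.mem_ker.mp (k u).2]

/-! ### Canonical codes of isomorphism classes -/

/-- The functions linearly isomorphic to `f`. -/
def linearOrbit {n : ℕ} (f : BoolFun n) : Set (BoolFun n) :=
  {f' | ∃ e : Cube n ≃ₗ[ZMod 2] Cube n, f ∘ e = f'}

theorem mem_linearOrbit_self {n : ℕ} (f : BoolFun n) : f ∈ linearOrbit f :=
  ⟨LinearEquiv.refl _ _, rfl⟩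

theorem linearOrbit_comp {n : ℕ} (f : BoolFun n) (e : Cube n ≃ₗ[ZMod 2] Cube n) :
    linearOrbit (f ∘ e) = linearOrbit f := by
  ext g
  constructor
  · rintro ⟨d, rfl⟩
    exact ⟨d.trans e, rfl⟩
  · rintro ⟨d, rfl⟩
    exact ⟨d.trans e.symm, by funext x; simp⟩

/-- A representative of the isomorphism class of `f` that depends on the class only. Choosing one
of smallest approximate spectral norm makes it unnecessary to know that this norm is an
invariant of the class. -/
noncomputable def orbitRep {n : ℕ} (f : BoolFun n) : BoolFun n :=
  Function.argminOn specCeil (linearOrbit f) ⟨f, mem_linearOrbit_self f⟩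

theorem orbitRep_comp {n : ℕ} (f : BoolFun n) (e : Cube n ≃ₗ[ZMod 2] Cube n) :
    orbitRep (f ∘ e) = orbitRep f := by
  simp only [orbitRep, linearOrbit_comp]

theorem exists_comp_eq_orbitRep {n : ℕ} (f : BoolFun n) :
    ∃ e : Cube n ≃ₗ[ZMod 2] Cube n, f ∘ e = orbitRep f :=
  Function.argminOn_mem specCeil (linearOrbit f) _

theorem specCeil_orbitRep_le {n : ℕ} (f : BoolFun n) : specCeil (orbitRep f) ≤ specCeil f :=
  Function.argminOn_le specCeil (linearOrbit f) (mem_linearOrbit_self f)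

/-- Isomorphism classes of Boolean functions of approximate spectral norm at most `s` can be
coded by a function on `Cube K` and a subset of `Cube K` in such a way that functions with the same
code have linear distance less than `ω`. -/
theorem exists_code {n : ℕ} {ω : ℝ} (hω : 0 < ω) {s K : ℕ} (hK : 20 * (s : ℝ) ^ 2 / ω ≤ K) :
    ∃ code : BoolFun n → BoolFun K × Set (Cube K),
      (∀ f (e : Cube n ≃ₗ[ZMod 2] Cube n), code (f ∘ e) = code f) ∧
      ∀ f g, specCeil (orbitRep f) ≤ s → specCeil (orbitRep g) ≤ s → code f = code g →
        linearDist f g < ω := by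
  have H : ∀ f : BoolFun n, ∃ p : BoolFun K × (Cube n →ₗ[ZMod 2] Cube K),
      specCeil f ≤ s → hammingDelta f (p.1 ∘ p.2) < ω / 2 := by
    intro f
    by_cases hs : specCeil f ≤ s
    · obtain ⟨φ, L, h⟩ := exists_close_comp_linearMap f hω hs hK
      exact ⟨(φ, L), fun _ => h⟩
    · exact ⟨(1, 0), fun h => absurd h hs⟩
  choose p hp using H
  refine ⟨fun f => ((p (orbitRep f)).1, Set.range (p (orbitRep f)).2), ?_, ?_⟩
  · intro f e
    simp only [orbitRep_comp]
  · intro f g hf hg hfg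
    simp only [Prod.mk.injEq] at hfg
    obtain ⟨hφ, hL⟩ := hfg
    have hf' := hp _ hf
    have hg' := hp _ hg
    obtain ⟨d, hd⟩ := exists_linearEquiv_comp_eq (p (orbitRep f)).2 (p (orbitRep g)).2
      (SetLike.coe_injective (by rw [LinearMap.coe_range, LinearMap.coe_range]; exact hL))
    obtain ⟨a, ha⟩ := exists_comp_eq_orbitRep f
    obtain ⟨b, hb⟩ := exists_comp_eq_orbitRep g
    refine (linearDist_le_hammingDelta f g a (d.trans b)).trans_lt ?_
    have h1 : g ∘ (d.trans b) = orbitRep g ∘ d := by rw [← hb]; rfl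
    have h2 : ((p (orbitRep g)).1 ∘ (p (orbitRep g)).2) ∘ d =
        (p (orbitRep f)).1 ∘ (p (orbitRep f)).2 := by
      funext x
      simp [hd, hφ]
    rw [h1, ha]
    refine (hammingDelta_triangle _ ((p (orbitRep f)).1 ∘ (p (orbitRep f)).2) _).trans_lt ?_
    rw [hammingDelta_comm _ (orbitRep g ∘ d), ← h2]
    have h3 := hammingDelta_comp_equiv (orbitRep g) ((p (orbitRep g)).1 ∘ (p (orbitRep g)).2)
      d.toEquiv
    rw [← h2] at hf'
    have h4 : hammingDelta (orbitRep g ∘ d) (((p (orbitRep g)).1 ∘ (p (orbitRep g)).2) ∘ d) =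
      hammingDelta (orbitRep g) ((p (orbitRep g)).1 ∘ (p (orbitRep g)).2) := h3
    rw [h4]
    linarith

/-! ### Counting strings by a part of their coordinates -/

/-- Under the uniform distribution on `κ → A`, the restriction to the coordinates in the range of
an injection `e : ι → κ` is uniform. -/
theorem card_filter_comp_mul {ι κ A : Type*} [Fintype ι] [Fintype κ] [DecidableEq ι]
    [DecidableEq κ] [Fintype A] {e : ι → κ} (he : Function.Injective e)
    (P : (ι → A) → Prop) [DecidablePred P] :
    (Finset.univ.filter fun r : κ → A => P (r ∘ e)).card * Fintype.card A ^ Fintype.card ι =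
      (Finset.univ.filter P).card * Fintype.card A ^ Fintype.card κ := by
  classical
  let Φ : (κ → A) ≃ (ι → A) × ({j // ¬ j ∈ Set.range e} → A) :=
    (Equiv.piEquivPiSubtypeProd (· ∈ Set.range e) fun _ => A).trans
      (Equiv.prodCongr ((Equiv.ofInjective e he).symm.arrowCongr (Equiv.refl A)) (Equiv.refl _))
  have hΦ : ∀ r, (Φ r).1 = r ∘ e := by
    intro r; funext i
    simp [Φ, Equiv.arrowCongr]
  have h1 : (Finset.univ.filter fun r : κ → A => P (r ∘ e)).card =
      ((Finset.univ.filter P) ×ˢ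
        (Finset.univ : Finset ({j // ¬ j ∈ Set.range e} → A))).card := by
    refine Finset.card_equiv Φ fun r => ?_
    simp [hΦ]
  have h2 : Fintype.card A ^ Fintype.card κ =
      Fintype.card A ^ Fintype.card ι * Fintype.card ({j // ¬ j ∈ Set.range e} → A) := by
    rw [← Fintype.card_fun, Fintype.card_congr Φ, Fintype.card_prod, Fintype.card_fun]
  rw [h1, h2, Finset.card_product, Finset.card_univ]
  ring

/-! ### Fingerprints -/

/-- A family of hash functions, one for each of `2 ^ (m + 2)` coin strings, under which any two
elements of a set of size at most `2 ^ 2 ^ m` collide with probability at most `1 / 4`: evaluate the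
polynomial of degree less than `2 ^ m` over the field with `2 ^ (m + 2)` elements that encodes the
element at a random point. -/
theorem exists_fingerprint {D : Type} [Finite D] (m : ℕ) (hD : Nat.card D ≤ 2 ^ 2 ^ m) :
    ∃ H : D → (Fin (m + 2) → Bool) → (Fin (m + 2) → Bool), ∀ d d', d ≠ d' →
      4 * (Finset.univ.filter fun r => H d r = H d' r).card ≤ 2 ^ (m + 2) := by
  classical
  have := Fintype.ofFinite D
  let F := GaloisField 2 (m + 2)
  have : Finite F := inferInstance
  have : Fintype F := Fintype.ofFinite F
  have hF : Fintype.card F = 2 ^ (m + 2) := by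
    rw [← Nat.card_eq_fintype_card]; exact GaloisField.card 2 (m + 2) (by omega)
  have hcard : Fintype.card D ≤ Fintype.card (Fin (2 ^ m) → F) := by
    rw [Nat.card_eq_fintype_card] at hD
    rw [Fintype.card_fun, hF, Fintype.card_fin]
    refine hD.trans (Nat.pow_le_pow_left ?_ _)
    calc 2 = 2 ^ 1 := rfl
      _ ≤ 2 ^ (m + 2) := Nat.pow_le_pow_right (by norm_num) (by omega)
  obtain ⟨u⟩ := Function.Embedding.nonempty_of_card_le hcard
  obtain ⟨b⟩ : Nonempty (F ≃ (Fin (m + 2) → Bool)) :=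
    ⟨Fintype.equivOfCardEq (by simp [hF])⟩
  let p : D → Polynomial.degreeLT F (2 ^ m) := fun d =>
    (Polynomial.degreeLTEquiv F (2 ^ m)).symm (u d)
  have hp : Function.Injective p := (LinearEquiv.injective _).comp u.injective
  refine ⟨fun d r => b ((p d).1.eval (b.symm r)), fun d d' hd => ?_⟩
  have hne : (p d).1 - (p d').1 ≠ 0 := sub_ne_zero.mpr fun h => hd (hp (Subtype.ext h))
  have hdeg : ((p d).1 - (p d').1).natDegree < 2 ^ m := by
    rw [Polynomial.natDegree_lt_iff_degree_lt hne]
    exact_mod_cast Polynomial.mem_degreeLT.mp ((p d) - (p d')).2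
  have hle : (Finset.univ.filter fun r =>
      b ((p d).1.eval (b.symm r)) = b ((p d').1.eval (b.symm r))).card ≤ 2 ^ m := by
    refine le_trans ?_ ((Polynomial.card_roots' _).trans hdeg.le)
    refine le_trans ?_ (Multiset.toFinset_card_le _)
    refine Finset.card_le_card_of_injOn b.symm (fun r hr => ?_) b.symm.injective.injOn
    have hr' := b.injective (Finset.mem_filter.mp hr).2
    simp [hne, hr']
  refine (Nat.mul_le_mul_left 4 hle).trans ?_
  rw [pow_add]
  omega

/-! ### An equality protocol whose cost depends on a parameter of the inputs -/

namespace Protocol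

variable {X Y : Type}

/-- Alice sends a string of `k` bits, and the protocol goes on with `next` of that string. -/
def aliceSend : (k : ℕ) → (X → Fin k → Bool) → ((Fin k → Bool) → Protocol X Y) → Protocol X Y
  | 0, _, next => next Fin.elim0
  | k + 1, msg, next => .alice (fun x => msg x 0) fun b =>
      aliceSend k (fun x i => msg x i.succ) fun w => next (Fin.cons b w)

theorem run_aliceSend (k : ℕ) (msg : X → Fin k → Bool) (next : (Fin k → Bool) → Protocol X Y)
    (x : X) (y : Y) : (aliceSend k msg next).run x y = (next (msg x)).run x y := by
  induction k with
  | zero => rw [aliceSend, Subsingleton.elim (msg x) Fin.elim0]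
  | succ k ih =>
    rw [aliceSend, run, ih]
    congr 2
    exact Fin.cons_self_tail (msg x)

theorem bits_aliceSend (k : ℕ) (msg : X → Fin k → Bool) (next : (Fin k → Bool) → Protocol X Y)
    (x : X) (y : Y) : (aliceSend k msg next).bits x y = (next (msg x)).bits x y + k := by
  induction k with
  | zero => rw [aliceSend, Subsingleton.elim (msg x) Fin.elim0, add_zero]
  | succ k ih =>
    rw [aliceSend, bits, ih, add_assoc]
    congr 3
    exact Fin.cons_self_tail (msg x)

/-- Alice sends the string `point x` and the hash of her input at it; Bob compares the hash with
his own. -/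
def compareHash {k l : ℕ} (point : X → Fin k → Bool) (hashA : X → (Fin k → Bool) → Fin l → Bool)
    (hashB : Y → (Fin k → Bool) → Fin l → Bool) : Protocol X Y :=
  aliceSend k point fun r => aliceSend l (fun x => hashA x (point x)) fun h =>
    .bob (fun y => decide (h = hashB y r)) .output

theorem run_compareHash {k l : ℕ} (point : X → Fin k → Bool)
    (hashA : X → (Fin k → Bool) → Fin l → Bool) (hashB : Y → (Fin k → Bool) → Fin l → Bool)
    (x : X) (y : Y) : (compareHash point hashA hashB).run x y =
      decide (hashA x (point x) = hashB y (point x)) := by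
  simp only [compareHash, run_aliceSend, run]

theorem bits_compareHash {k l : ℕ} (point : X → Fin k → Bool)
    (hashA : X → (Fin k → Bool) → Fin l → Bool) (hashB : Y → (Fin k → Bool) → Fin l → Bool)
    (x : X) (y : Y) : (compareHash point hashA hashB).bits x y = k + l + 1 := by
  simp only [compareHash, bits_aliceSend, bits]
  omega

/-- Alice and Bob compare their levels `a x` and `b y` with `s`, `s + 1`, … until one of them is
reached. If only one of them is, the protocol rejects; otherwise it runs `Q` for this level. The
first argument bounds the number of rounds. -/
def findLevel (a : X → ℕ) (b : Y → ℕ) (Q : ℕ → Protocol X Y) : ℕ → ℕ → Protocol X Y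
  | 0, _ => .output false
  | fuel + 1, s => .alice (fun x => decide (a x ≤ s)) fun i =>
      .bob (fun y => decide (b y ≤ s)) fun j =>
        if i && j then Q s else if i || j then .output false else findLevel a b Q fuel (s + 1)

theorem run_findLevel (a : X → ℕ) (b : Y → ℕ) (Q : ℕ → Protocol X Y) (fuel s : ℕ) (x : X) (y : Y)
    (h1 : s ≤ min (a x) (b y)) (h2 : min (a x) (b y) < s + fuel) :
    (findLevel a b Q fuel s).run x y = (decide (a x = b y) && (Q (a x)).run x y) := by
  induction fuel generalizing s with
  | zero => omega
  | succ fuel ih =>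
    rw [findLevel, run, run]
    by_cases hx : a x ≤ s <;> by_cases hy : b y ≤ s
    · have h3 : a x = s := by omega
      have h4 : b y = s := by omega
      simp [h3, h4]
    · have h3 : a x ≠ b y := by omega
      simp [hx, hy, h3, run]
    · have h3 : a x ≠ b y := by omega
      simp [hx, hy, h3, run]
    · simpa [hx, hy] using ih (s + 1) (by omega) (by omega)

theorem bits_findLevel_le (a : X → ℕ) (b : Y → ℕ) (Q : ℕ → Protocol X Y) (fuel s : ℕ) (x : X)
    (y : Y) (h1 : s ≤ min (a x) (b y)) :
    (findLevel a b Q fuel s).bits x y ≤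
      2 * (min (a x) (b y) + 1 - s) + (Q (min (a x) (b y))).bits x y := by
  induction fuel generalizing s with
  | zero => simp [findLevel, bits]
  | succ fuel ih =>
    rw [findLevel, bits, bits]
    by_cases hx : a x ≤ s <;> by_cases hy : b y ≤ s
    · have h3 : a x = s := by omega
      have h4 : b y = s := by omega
      simp [h3, h4]
      omega
    · simp [hx, hy, bits]; omega
    · simp [hx, hy, bits]; omega
    · have := ih (s + 1) (by omega)
      simp only [hx, hy, decide_false, Bool.and_self, Bool.or_self, Bool.false_eq_true, if_false]
      omega

end Protocol

theorem PrivateCoinProtocol.outputProb_true_add_false {X Y : Type} (P : PrivateCoinProtocol X Y)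
    (x : X) (y : Y) : P.outputProb x y true + P.outputProb x y false = 1 := by
  rw [outputProb, outputProb, ← add_div, div_eq_one_iff_eq (by simp)]
  have := Finset.card_filter_add_card_filter_not (s := (Finset.univ : Finset P.Coins))
    (fun r => P.tree.run (x, r.1) (y, r.2) = true)
  simp only [Bool.not_eq_true] at this
  exact_mod_cast this

/-- A private-coin protocol that tests whether the inputs have the same level `τ` and, if so,
whether their hashes at this level agree at a random point. It never rejects when all hashes agree, and it
rejects with probability at least `2 / 3` when they agree at no more than a third of the points. -/
theorem exists_levelwise_equality_protocol {X : Type} [Finite X] (τ : X → ℕ) (q : ℕ → ℕ)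
    (H : (s : ℕ) → X → (Fin (q s) → Bool) → (Fin (q s) → Bool)) :
    ∃ P : PrivateCoinProtocol X X,
      (∀ x y, τ x = τ y → H (τ x) x = H (τ x) y → P.outputProb x y true = 1) ∧
      (∀ x y, (τ x = τ y → 3 * (Finset.univ.filter fun r => H (τ x) x r = H (τ x) y r).card ≤
        2 ^ q (τ x)) → 2 / 3 ≤ P.outputProb x y false) ∧
      ∀ x y, P.cost x y ≤ 2 * min (τ x) (τ y) + 2 * q (min (τ x) (τ y)) + 3 := by
  classical
  have := Fintype.ofFinite X
  set S := Finset.univ.sup τ with hS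
  have hτ : ∀ x, τ x ≤ S := fun x => Finset.le_sup (Finset.mem_univ x)
  set A := (Finset.range (S + 1)).sup q with hA
  have hq : ∀ x, q (τ x) ≤ A := fun x =>
    Finset.le_sup (Finset.mem_range.mpr (Nat.lt_succ_of_le (hτ x)))
  let pre : (s : ℕ) → (Fin A → Bool) → Fin (q s) → Bool := fun s r i =>
    if h : i.1 < A then r ⟨i, h⟩ else false
  have hpre : ∀ x r, pre (τ x) r = r ∘ Fin.castLE (hq x) := by
    intro x r; funext i
    simp [pre, i.2.trans_le (hq x), Fin.castLE]
  let Q : ℕ → Protocol (X × (Fin A → Bool)) (X × (Fin 0 → Bool)) := fun s =>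
    .compareHash (fun x => pre s x.2) (fun x => H s x.1) (fun y => H s y.1)
  let P : PrivateCoinProtocol X X :=
    ⟨A, 0, .findLevel (fun x => τ x.1) (fun y => τ y.1) Q (S + 1) 0⟩
  have hrun : ∀ x y (r : P.Coins), P.tree.run (x, r.1) (y, r.2) =
      (decide (τ x = τ y) && decide (H (τ x) x (pre (τ x) r.1) = H (τ x) y (pre (τ x) r.1))) := by
    intro x y r
    have h1 := hτ x
    refine (Protocol.run_findLevel (fun x : X × (Fin A → Bool) => τ x.1)
      (fun y : X × (Fin 0 → Bool) => τ y.1) Q (S + 1) 0 (x, r.1) (y, r.2)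
      (Nat.zero_le _) ?_).trans ?_
    · show min (τ x) (τ y) < 0 + (S + 1)
      omega
    · simp only [Q, Protocol.run_compareHash]
  have hcoins : Fintype.card P.Coins = 2 ^ A := by
    simp [PrivateCoinProtocol.Coins, P]
  refine ⟨P, ?_, ?_, ?_⟩
  · intro x y h1 h2
    rw [PrivateCoinProtocol.outputProb]
    simp only [hrun]
    simp [h1, ← h2]
  · intro x y h
    suffices h3 : P.outputProb x y true ≤ 1 / 3 by
      have := P.outputProb_true_add_false x y
      linarith
    rw [PrivateCoinProtocol.outputProb, hcoins]
    simp only [hrun]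
    by_cases hxy : τ x = τ y
    · have h1 := h hxy
      have h2 := card_filter_comp_mul (Fin.castLE_injective (hq x))
        (fun r : Fin (q (τ x)) → Bool => H (τ x) x r = H (τ x) y r)
      simp only [Fintype.card_bool, Fintype.card_fin] at h2
      have h4 : (Finset.univ.filter fun r : P.Coins => (decide (τ x = τ y) &&
            decide (H (τ x) x (pre (τ x) r.1) = H (τ x) y (pre (τ x) r.1))) = true).card =
          (Finset.univ.filter fun r : Fin A → Bool => H (τ x) x (r ∘ Fin.castLE (hq x)) =
            H (τ x) y (r ∘ Fin.castLE (hq x))).card := by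
        refine Finset.card_equiv (Equiv.prodUnique _ _) fun r => ?_
        simp only [Finset.mem_filter, Finset.mem_univ, true_and, hxy, ← hpre]
        simp
      rw [h4, div_le_iff₀ (by positivity)]
      have h5 : 3 * (Finset.univ.filter fun r : Fin A → Bool => H (τ x) x (r ∘ Fin.castLE (hq x)) =
            H (τ x) y (r ∘ Fin.castLE (hq x))).card ≤ 2 ^ A := by
        refine Nat.le_of_mul_le_mul_right ?_ (by positivity : 0 < 2 ^ q (τ x))
        rw [mul_assoc, h2, ← mul_assoc, mul_comm (2 ^ A)]
        exact Nat.mul_le_mul_right _ h1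
      have h6 : (3 : ℝ) * (Finset.univ.filter fun r : Fin A → Bool =>
          H (τ x) x (r ∘ Fin.castLE (hq x)) = H (τ x) y (r ∘ Fin.castLE (hq x))).card ≤ 2 ^ A := by
        exact_mod_cast h5
      push_cast
      linarith
    · simp [hxy]
  · intro x y
    refine Finset.sup_le fun r _ => ?_
    refine (Protocol.bits_findLevel_le (fun x : X × (Fin A → Bool) => τ x.1)
      (fun y : X × (Fin 0 → Bool) => τ y.1) Q (S + 1) 0 (x, r.1) (y, r.2)
      (Nat.zero_le _)).trans ?_
    simp only [Q, Protocol.bits_compareHash]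
    omega

/-! ### The upper bound -/

theorem card_codes (K : ℕ) : Nat.card (BoolFun K × Set (Cube K)) = 2 ^ 2 ^ (K + 1) := by
  classical
  rw [Nat.card_eq_fintype_card, Fintype.card_prod, Fintype.card_fun, Fintype.card_set]
  simp only [Fintype.card_units_int, Fintype.card_fun, ZMod.card, Fintype.card_fin]
  rw [← pow_add, ← two_mul, ← pow_succ']

theorem exists_protocol_decidesLinIso {n : ℕ} {ω : ℝ} (hω : 0 < ω) :
    ∃ P : PrivateCoinProtocol (BoolFun n) (BoolFun n), DecidesLinIso P ω ∧
      ∀ f g : BoolFun n, (P.cost f g : ℝ) ≤ 53 * ((specParam f g : ℝ) ^ 2 / ω ^ 3) := by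
  rcases lt_or_ge 1 ω with hω1 | hω1
  · refine ⟨⟨0, 0, .output true⟩, fun f g => ⟨fun _ => ?_, fun h => ?_⟩, fun f g => ?_⟩
    · norm_num [PrivateCoinProtocol.outputProb, Protocol.run]
    · exact absurd (h.trans (linearDist_le_one f g)) hω1.not_ge
    · have : PrivateCoinProtocol.cost ⟨0, 0, .output true⟩ f g = 0 := by
        simp [PrivateCoinProtocol.cost, Protocol.bits]
      rw [this, Nat.cast_zero]
      positivity
  let K : ℕ → ℕ := fun s => ⌈20 * (s : ℝ) ^ 2 / ω⌉₊
  have hcode := fun s : ℕ => exists_code (n := n) hω (s := s) (K := K s) (Nat.le_ceil _)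
  choose code hinv hsound using hcode
  have hfp := fun s : ℕ => exists_fingerprint (D := BoolFun (K s) × Set (Cube (K s))) (K s + 1)
    (card_codes _).le
  choose H hH using hfp
  obtain ⟨P, hP1, hP2, hP3⟩ := exists_levelwise_equality_protocol
    (fun f : BoolFun n => specCeil (orbitRep f)) (fun s => K s + 1 + 2)
    (fun s f => H s (code s f))
  refine ⟨P, fun f g => ⟨fun h => ?_, fun h => ?_⟩, fun f g => ?_⟩
  · obtain ⟨e, rfl⟩ := exists_comp_eq_of_linearDist_eq_zero h
    rw [hP1 _ _ (by rw [orbitRep_comp]) (by rw [hinv])]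
    norm_num
  · refine hP2 f g fun hτ => ?_
    have hne : code (specCeil (orbitRep f)) f ≠ code (specCeil (orbitRep f)) g := fun hc =>
      (hsound _ f g le_rfl hτ.ge hc).not_ge h
    have := hH _ _ _ hne
    omega
  · set m := min (specCeil (orbitRep f)) (specCeil (orbitRep g)) with hm
    set t := specParam f g with ht
    have hmt : (m : ℝ) ≤ t := by
      exact_mod_cast min_le_min (specCeil_orbitRep_le f) (specCeil_orbitRep_le g)
    have ht1 : (1 : ℝ) ≤ t := by
      exact_mod_cast le_min (one_le_specCeil f) (one_le_specCeil g)
    have h1 : (P.cost f g : ℝ) ≤ 2 * m + 2 * (K m + 1 + 2) + 3 := by exact_mod_cast hP3 f g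
    have h2 : (K m : ℝ) ≤ 20 * (m : ℝ) ^ 2 / ω + 1 := (Nat.ceil_lt_add_one (by positivity)).le
    have h3 : 20 * (m : ℝ) ^ 2 / ω ≤ 20 * (t ^ 2 / ω) := by
      rw [mul_div_assoc]; gcongr
    have h4 : (t : ℝ) ^ 2 / ω ≤ t ^ 2 / ω ^ 3 := by
      gcongr
      exact pow_le_of_le_one hω.le hω1 (by norm_num)
    have h5 : (t : ℝ) ^ 2 ≤ t ^ 2 / ω := by
      rw [le_div_iff₀ hω]
      exact mul_le_of_le_one_right (by positivity) hω1
    nlinarith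

/-! ### A family of bent functions -/

/-- Extension by zero along an injection `e`: a function on `ι` becomes a function on `κ` that
vanishes outside the range of `e`. -/
noncomputable abbrev zeroExtend {ι κ : Type*} (e : ι → κ) : (ι → ZMod 2) →ₗ[ZMod 2] (κ → ZMod 2) :=
  Function.ExtendByZero.linearMap (ZMod 2) e

theorem zeroExtend_comp {ι κ : Type*} {e : ι → κ} (he : Function.Injective e)
    (u : ι → ZMod 2) : zeroExtend e u ∘ e = u := by
  funext i
  exact he.extend_apply _ _ i

theorem zeroExtend_apply_of_notMem {ι κ : Type*} {e : ι → κ} (u : ι → ZMod 2) {j : κ}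
    (hj : j ∉ Set.range e) : zeroExtend e u j = 0 :=
  Function.extend_apply' _ _ _ hj

theorem dotProduct_zeroExtend {ι κ : Type*} [Fintype ι] [Fintype κ] {e : ι → κ}
    (he : Function.Injective e) (α : κ → ZMod 2) (u : ι → ZMod 2) :
    α ⬝ᵥ zeroExtend e u = (α ∘ e) ⬝ᵥ u := by
  refine (Fintype.sum_of_injective e he _ _ (fun j hj => ?_) fun i => ?_).symm
  · rw [zeroExtend_apply_of_notMem u hj, mul_zero]
  · have := congrFun (zeroExtend_comp he u) i
    rw [Function.comp_apply] at this
    rw [this, Function.comp_apply]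

/-- The Maiorana–McFarland function `(x, y) ↦ (-1)^⟨x, y⟩ h(y)` on `𝔽₂ᵏ × 𝔽₂ᵏ`. -/
def bentFun {k : ℕ} (h : BoolFun k) (u : Fin k ⊕ Fin k → ZMod 2) : ℤˣ :=
  (-1) ^ ((u ∘ Sum.inl) ⬝ᵥ (u ∘ Sum.inr)).val * h (u ∘ Sum.inr)

/-- The function `bentFun h` of the coordinates selected by `e`. -/
def bentLift {n k : ℕ} (e : Fin k ⊕ Fin k → Fin n) (h : BoolFun k) : BoolFun n :=
  fun x => bentFun h (x ∘ e)

theorem abs_toReal {n : ℕ} (f : BoolFun n) (x : Cube n) : |f.toReal x| = 1 := by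
  rcases toReal_eq f x with ⟨-, h⟩ | ⟨-, h⟩ <;> rw [h] <;> norm_num

theorem toReal_bentLift_add {n k : ℕ} {e : Fin k ⊕ Fin k → Fin n} (he : Function.Injective e)
    (h : BoolFun k) (x : Cube n) (w : Cube k) :
    (bentLift e h).toReal (x + zeroExtend (e ∘ Sum.inl) w) =
      (bentLift e h).toReal x * parityChar (x ∘ e ∘ Sum.inr) w := by
  have h1 : (x + zeroExtend (e ∘ Sum.inl) w) ∘ e ∘ Sum.inl = x ∘ e ∘ Sum.inl + w := by
    rw [Pi.add_comp, zeroExtend_comp (he.comp Sum.inl_injective)]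
  have h2 : (x + zeroExtend (e ∘ Sum.inl) w) ∘ e ∘ Sum.inr = x ∘ e ∘ Sum.inr := by
    rw [Pi.add_comp]
    convert add_zero _ using 2
    funext i
    refine zeroExtend_apply_of_notMem w ?_
    rintro ⟨j, hj⟩
    exact Sum.inl_ne_inr (he hj)
  simp only [BoolFun.toReal, bentLift, bentFun, Function.comp_assoc, h1, h2, add_dotProduct,
    neg_one_pow_val_add, parityChar]
  push_cast
  rw [dotProduct_comm w]
  ring

theorem sum_cube_translate {n : ℕ} (F : Cube n → ℝ) (y : Cube n) : ∑ x, F (x + y) = ∑ x, F x :=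
  Equiv.sum_comp (Equiv.addRight y) F

/-- Bentness: no Fourier coefficient exceeds `2⁻ᵏ`. Averaging over translations of the first block
of coordinates kills all points whose second block is not the one prescribed by `α`. -/
theorem abs_sum_bentLift_mul_parityChar_le {n k : ℕ} {e : Fin k ⊕ Fin k → Fin n}
    (he : Function.Injective e) (h : BoolFun k) (α : Cube n) :
    |∑ x, (bentLift e h).toReal x * parityChar α x| ≤ 2 ^ n / 2 ^ k := by
  set F : Cube n → ℝ := fun x => (bentLift e h).toReal x * parityChar α x with hF
  have hFabs : ∀ x, |F x| = 1 := fun x => by rw [hF, abs_mul, abs_toReal, abs_parityChar, one_mul]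
  have h1 : ∀ x w, F (x + zeroExtend (e ∘ Sum.inl) w) =
      F x * parityChar (x ∘ e ∘ Sum.inr + α ∘ e ∘ Sum.inl) w := by
    intro x w
    have h2 : parityChar α (zeroExtend (e ∘ Sum.inl) w) = parityChar (α ∘ e ∘ Sum.inl) w := by
      simp only [parityChar, dotProduct_zeroExtend (he.comp Sum.inl_injective)]
    simp only [hF]
    rw [toReal_bentLift_add he, parityChar_add_right, parityChar_add_left, h2]
    ring
  have h3 : (2 : ℝ) ^ k * ∑ x, F x =
      2 ^ k * ∑ x, if x ∘ e ∘ Sum.inr = α ∘ e ∘ Sum.inl then F x else 0 := by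
    calc (2 : ℝ) ^ k * ∑ x, F x = ∑ w : Cube k, ∑ x, F (x + zeroExtend (e ∘ Sum.inl) w) := by
          simp [sum_cube_translate, ZMod.card]
      _ = ∑ x, F x * ∑ w : Cube k, parityChar (x ∘ e ∘ Sum.inr + α ∘ e ∘ Sum.inl) w := by
          rw [Finset.sum_comm]
          simp only [h1, Finset.mul_sum]
      _ = _ := by
          rw [Finset.mul_sum]
          refine Finset.sum_congr rfl fun x _ => ?_
          rw [sum_parityChar]
          have h4 : x ∘ e ∘ Sum.inr + α ∘ e ∘ Sum.inl = 0 ↔ x ∘ e ∘ Sum.inr = α ∘ e ∘ Sum.inl := by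
            constructor
            · intro h5
              have := congrArg (· + α ∘ e ∘ Sum.inl) h5
              simpa [add_assoc, cube_add_self] using this
            · intro h5; rw [h5, cube_add_self]
          simp only [h4]
          split_ifs <;> ring
  rw [mul_left_cancel₀ (by positivity) h3, ← Finset.sum_filter]
  refine (Finset.abs_sum_le_sum_abs _ _).trans ?_
  simp only [hFabs, Finset.sum_const, nsmul_eq_mul, mul_one]
  have h6 := card_filter_comp_mul (A := ZMod 2) (he.comp Sum.inr_injective)
    (fun y => y = α ∘ e ∘ Sum.inl)
  rw [Finset.filter_eq' _ (α ∘ e ∘ Sum.inl)] at h6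
  simp only [ZMod.card, Fintype.card_fin, Finset.mem_univ, if_true, Finset.card_singleton,
    one_mul] at h6
  rw [le_div_iff₀ (by positivity)]
  exact_mod_cast h6.le

theorem fourierCoeffCube_bentLift_eq_zero {n k : ℕ} {e : Fin k ⊕ Fin k → Fin n} (h : BoolFun k)
    {α : Cube n} {i : Fin n} (hi : i ∉ Set.range e) (hα : α i ≠ 0) :
    fourierCoeffCube (bentLift e h).toReal α = 0 := by
  have h1 : α i = 1 := by
    generalize α i = a at hα
    fin_cases a
    · exact absurd rfl hα
    · rfl
  have h2 := sum_cube_translate (fun x => (bentLift e h).toReal x * parityChar α x) (Pi.single i 1)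
  have h3 : ∀ x, (bentLift e h).toReal (x + Pi.single i 1) = (bentLift e h).toReal x := by
    intro x
    have : (x + Pi.single i 1) ∘ e = x ∘ e := by
      funext j
      have : e j ≠ i := fun hj => hi ⟨j, hj⟩
      simp [this]
    simp only [BoolFun.toReal, bentLift, this]
  have h4 : parityChar α (Pi.single i 1) = -1 := by simp [parityChar, h1, ZMod.val_one]
  simp only [h3, parityChar_add_right, h4, mul_neg, mul_one, Finset.sum_neg_distrib] at h2
  rw [fourierCoeffCube, show ∑ x, (bentLift e h).toReal x * parityChar α x = 0 by linarith,
    zero_div]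

theorem spectralNorm1_bentLift_le {n k : ℕ} {e : Fin k ⊕ Fin k → Fin n}
    (he : Function.Injective e) (h : BoolFun k) :
    spectralNorm1 (bentLift e h).toReal ≤ 2 ^ k := by
  classical
  set S : Finset (Cube n) := Finset.univ.filter fun α => ∀ i ∉ Set.range e, α i = 0 with hS
  have h1 : S.card ≤ 2 ^ (k + k) := by
    have : Fintype.card (Fin k ⊕ Fin k → ZMod 2) = 2 ^ (k + k) := by simp [ZMod.card]
    rw [← this, ← Finset.card_univ]
    refine Finset.card_le_card_of_injOn (· ∘ e) (fun _ _ => Finset.mem_univ _) ?_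
    intro α hα β hβ hαβ
    have hα' := (Finset.mem_filter.mp hα).2
    have hβ' := (Finset.mem_filter.mp hβ).2
    funext i
    by_cases hi : i ∈ Set.range e
    · obtain ⟨j, rfl⟩ := hi
      exact congrFun hαβ j
    · rw [hα' i hi, hβ' i hi]
  have h2 : ∀ α, |fourierCoeffCube (bentLift e h).toReal α| ≤ 1 / 2 ^ k := by
    intro α
    rw [fourierCoeffCube, abs_div, abs_of_pos (by positivity : (0 : ℝ) < 2 ^ n),
      div_le_iff₀ (by positivity)]
    exact (abs_sum_bentLift_mul_parityChar_le he h α).trans_eq (by ring)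
  have h3 : spectralNorm1 (bentLift e h).toReal =
      ∑ α ∈ S, |fourierCoeffCube (bentLift e h).toReal α| := by
    refine (Finset.sum_subset (Finset.subset_univ S) fun α _ hα => ?_).symm
    simp only [hS, Finset.mem_filter, Finset.mem_univ, true_and, not_forall] at hα
    obtain ⟨i, hi, hαi⟩ := hα
    rw [fourierCoeffCube_bentLift_eq_zero h hi hαi, abs_zero]
  rw [h3]
  refine (Finset.sum_le_card_nsmul _ _ _ fun α _ => h2 α).trans ?_
  rw [nsmul_eq_mul, mul_one_div, div_le_iff₀ (by positivity), ← pow_add]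
  exact_mod_cast h1

/-- Fourier duality with the bent function itself. -/
theorem le_spectralNorm1_of_close_bentLift {n k : ℕ} {e : Fin k ⊕ Fin k → Fin n}
    (he : Function.Injective e) (h : BoolFun k) (h' : Cube n → ℝ)
    (hh : ∀ x, |(bentLift e h).toReal x - h' x| ≤ 1 / 3) : 2 / 3 * 2 ^ k ≤ spectralNorm1 h' := by
  have h1 : ∀ x, 2 / 3 ≤ (bentLift e h).toReal x * h' x := by
    intro x
    have h2 := abs_le.mp (hh x)
    rcases toReal_eq (bentLift e h) x with ⟨-, h3⟩ | ⟨-, h3⟩ <;> rw [h3] at h2 ⊢ <;> linarith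
  have h4 : (2 : ℝ) ^ n * (2 / 3) ≤ ∑ x, (bentLift e h).toReal x * h' x := by
    have := Finset.card_nsmul_le_sum Finset.univ (fun x => (bentLift e h).toReal x * h' x) _
      fun x _ => h1 x
    simpa [ZMod.card] using this
  have h5 : ∑ x, (bentLift e h).toReal x * h' x =
      ∑ α, fourierCoeffCube h' α * ∑ x, (bentLift e h).toReal x * parityChar α x := by
    simp only [Finset.mul_sum]
    rw [Finset.sum_comm]
    refine Finset.sum_congr rfl fun x _ => ?_
    conv_lhs => rw [← sum_fourierCoeffCube_mul_parityChar h' x, Finset.mul_sum]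
    exact Finset.sum_congr rfl fun α _ => by ring
  have h6 : ∑ x, (bentLift e h).toReal x * h' x ≤ spectralNorm1 h' * (2 ^ n / 2 ^ k) := by
    rw [h5, spectralNorm1, Finset.sum_mul]
    refine Finset.sum_le_sum fun α _ => (le_abs_self _).trans ?_
    rw [abs_mul]
    exact mul_le_mul_of_nonneg_left (abs_sum_bentLift_mul_parityChar_le he h α) (abs_nonneg _)
  have h7 : (2 : ℝ) ^ n * (2 / 3) ≤ spectralNorm1 h' * 2 ^ n / 2 ^ k :=
    (h4.trans h6).trans_eq (mul_div_assoc _ _ _).symm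
  rw [le_div_iff₀ (by positivity)] at h7
  have h8 : (0 : ℝ) < 2 ^ n := by positivity
  nlinarith

theorem specCeil_bentLift_le {n k : ℕ} {e : Fin k ⊕ Fin k → Fin n}
    (he : Function.Injective e) (h : BoolFun k) : specCeil (bentLift e h) ≤ 2 ^ k := by
  refine Nat.ceil_le.mpr ?_
  exact_mod_cast (approxSpectralNorm_le (by norm_num) _).trans (spectralNorm1_bentLift_le he h)

theorem le_specCeil_bentLift {n k : ℕ} {e : Fin k ⊕ Fin k → Fin n}
    (he : Function.Injective e) (h : BoolFun k) : 2 / 3 * 2 ^ k ≤ (specCeil (bentLift e h) : ℝ) :=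
  (le_approxSpectralNorm (by norm_num) (le_spectralNorm1_of_close_bentLift he h)).trans
    (Nat.le_ceil _)

/-! ### A large family of bent functions at pairwise large linear distance -/

/-- If two functions of the coordinates in the range of `e` are linearly close in the whole cube, then
an affine (not necessarily invertible) substitution in these coordinates alone makes them
close: fix the other coordinates to suitable values. -/
theorem exists_affine_of_linearDist_lt {n : ℕ} {ι : Type*} [Fintype ι] [DecidableEq ι]
    {e : ι → Fin n} (he : Function.Injective e) (F G : (ι → ZMod 2) → ℤˣ) {δ : ℝ}
    (h : linearDist (fun x : Cube n => F (x ∘ e)) (fun x => G (x ∘ e)) < δ) :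
    ∃ (A : Matrix ι ι (ZMod 2)) (c : ι → ZMod 2),
      ((Finset.univ.filter fun u => F (A *ᵥ u + c) ≠ G u).card : ℝ) <
        δ * 2 ^ Fintype.card ι := by
  obtain ⟨d, hd⟩ := exists_linearDist_eq (fun x : Cube n => F (x ∘ e)) (fun x => G (x ∘ e))
  rw [hd, hammingDelta, div_lt_iff₀ (by positivity)] at h
  have hex : ∃ x : Cube n, ((Finset.univ.filter fun u =>
      F (d (x + zeroExtend e u) ∘ e) ≠ G ((x + zeroExtend e u) ∘ e)).card : ℝ) <
        δ * 2 ^ Fintype.card ι := by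
    by_contra! H
    have h1 := Finset.card_nsmul_le_sum Finset.univ _ _ fun x _ => H x
    have h2 : ∑ x : Cube n, ((Finset.univ.filter fun u =>
        F (d (x + zeroExtend e u) ∘ e) ≠ G ((x + zeroExtend e u) ∘ e)).card : ℝ) =
        2 ^ Fintype.card ι *
          (Finset.univ.filter fun x : Cube n => F (d x ∘ e) ≠ G (x ∘ e)).card := by
      simp only [Finset.natCast_card_filter]
      rw [Finset.sum_comm]
      have h3 := fun u => sum_cube_translate
        (fun x : Cube n => if F (d x ∘ e) ≠ G (x ∘ e) then (1 : ℝ) else 0) (zeroExtend e u)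
      simp only [h3]
      simp [ZMod.card]
    rw [h2] at h1
    simp only [Finset.card_univ, Fintype.card_fun, ZMod.card, Fintype.card_fin, nsmul_eq_mul,
      Nat.cast_pow, Nat.cast_ofNat] at h1
    have h4 : (0 : ℝ) < 2 ^ Fintype.card ι := by positivity
    have h5 := mul_lt_mul_of_pos_left h h4
    simp only [Function.comp_apply] at h5
    nlinarith
  obtain ⟨x, hx⟩ := hex
  let A' : (ι → ZMod 2) →ₗ[ZMod 2] (ι → ZMod 2) :=
    LinearMap.funLeft (ZMod 2) (ZMod 2) e ∘ₗ d.toLinearMap ∘ₗ zeroExtend e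
  refine ⟨LinearMap.toMatrix' A', A' (x ∘ e) + d x ∘ e, lt_of_le_of_lt ?_ hx⟩
  rw [Nat.cast_le]
  refine Finset.card_le_card_of_injOn (· + x ∘ e) (fun u hu => ?_)
    (fun _ _ _ _ hab => add_right_cancel hab)
  simp only [Finset.coe_filter, Finset.mem_univ, true_and, Set.mem_ofPred_eq] at hu ⊢
  have h6 : d (x + zeroExtend e (u + x ∘ e)) ∘ e =
      LinearMap.toMatrix' A' *ᵥ u + (A' (x ∘ e) + d x ∘ e) := by
    rw [LinearMap.toMatrix'_mulVec, ← add_assoc, ← map_add, map_add d, Pi.add_comp, add_comm]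
    rfl
  have h7 : (x + zeroExtend e (u + x ∘ e)) ∘ e = u := by
    rw [Pi.add_comp, zeroExtend_comp he, add_comm u, ← add_assoc, cube_add_self, zero_add]
  rwa [h6, h7]

/-- A Hamming ball of relative radius `1 / 10` in `Y → {-1, 1}` contains at most the square root of
all points. -/
theorem card_hammingBall_sq_le {Y : Type*} [Fintype Y] [DecidableEq Y] (h₀ : Y → ℤˣ) :
    (Finset.univ.filter fun h : Y → ℤˣ =>
      10 * (Finset.univ.filter fun y => h y ≠ h₀ y).card ≤ Fintype.card Y).card ^ 2 ≤
      2 ^ Fintype.card Y := by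
  set N := Fintype.card Y with hN
  set ball := Finset.univ.filter fun h : Y → ℤˣ =>
    10 * (Finset.univ.filter fun y => h y ≠ h₀ y).card ≤ N with hball
  -- Each point at distance `d` from the centre gets the weight `8⁻ᵈ`.
  let w : (Y → ℤˣ) → ℝ := fun h => ∏ y, if h y ≠ h₀ y then 1 / 8 else 1
  have hw : ∀ h, w h = (1 / 8) ^ (Finset.univ.filter fun y => h y ≠ h₀ y).card := by
    intro h
    simp only [w, Finset.prod_ite, Finset.prod_const, one_pow, mul_one]
  have htotal : ∑ h, w h = (9 / 8) ^ N := by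
    have h1 := (Fintype.prod_sum fun (y : Y) (s : ℤˣ) =>
      if s ≠ h₀ y then (1 / 8 : ℝ) else 1)
    have h2 : ∀ y : Y, ∑ s : ℤˣ, (if s ≠ h₀ y then (1 / 8 : ℝ) else 1) = 9 / 8 := by
      intro y
      rcases Int.units_eq_one_or (h₀ y) with h3 | h3 <;> rw [h3] <;>
        simp [UnitsInt.univ] <;> norm_num
    simp only [h2, Finset.prod_const, Finset.card_univ] at h1
    exact h1.symm
  have h4 : (ball.card : ℝ) * (1 / 8) ^ (N / 10) ≤ (9 / 8) ^ N := by
    rw [← htotal, ← nsmul_eq_mul]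
    refine (Finset.card_nsmul_le_sum ball w _ fun h hh => ?_).trans
      (Finset.sum_le_univ_sum_of_nonneg fun h => by
        show 0 ≤ w h
        rw [hw]; positivity)
    rw [hw]
    have := (Finset.mem_filter.mp hh).2
    exact pow_le_pow_of_le_one (by norm_num) (by norm_num) (by omega)
  have h5 : (ball.card : ℝ) ≤ (9 / 8) ^ N * 8 ^ (N / 10) := by
    rw [one_div, inv_pow, ← div_eq_mul_inv, div_le_iff₀ (by positivity)] at h4
    exact h4
  have h6 : ((ball.card : ℝ) ^ 2) ^ 5 ≤ (2 ^ N) ^ 5 := by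
    calc ((ball.card : ℝ) ^ 2) ^ 5 = (ball.card : ℝ) ^ 10 := by ring
      _ ≤ ((9 / 8) ^ N * 8 ^ (N / 10)) ^ 10 := by gcongr
      _ = ((9 / 8) ^ 10) ^ N * 8 ^ (N / 10 * 10) := by rw [mul_pow, ← pow_mul, ← pow_mul,
          ← pow_mul, mul_comm N]
      _ ≤ ((9 / 8) ^ 10) ^ N * 8 ^ N := by
          gcongr
          · norm_num
          · omega
      _ = ((9 / 8) ^ 10 * 8) ^ N := by rw [mul_pow]
      _ ≤ (2 ^ 5) ^ N := by gcongr; norm_num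
      _ = (2 ^ N) ^ 5 := by rw [← pow_mul, ← pow_mul, mul_comm]
  exact_mod_cast le_of_pow_le_pow_left₀ (by norm_num) (by positivity) h6

/-- Few members of the bent family are close to any given function on `𝔽₂²ᵏ`: two of them
are as far from each other as their parameters. -/
theorem card_close_bentFun_le {k : ℕ} (hk : 1 ≤ k) (F : (Fin k ⊕ Fin k → ZMod 2) → ℤˣ) :
    (Finset.univ.filter fun h : BoolFun k =>
      ((Finset.univ.filter fun u => F u ≠ bentFun h u).card : ℝ) <
        1 / 20 * 2 ^ Fintype.card (Fin k ⊕ Fin k)).card ≤ 2 ^ 2 ^ (k - 1) := by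
  set S := Finset.univ.filter fun h : BoolFun k =>
      ((Finset.univ.filter fun u => F u ≠ bentFun h u).card : ℝ) <
        1 / 20 * 2 ^ Fintype.card (Fin k ⊕ Fin k) with hS
  rcases S.eq_empty_or_nonempty with h0 | ⟨h₁, hh₁⟩
  · simp [h0]
  have hball : S ⊆ Finset.univ.filter fun h : BoolFun k =>
      10 * (Finset.univ.filter fun y => h y ≠ h₁ y).card ≤ Fintype.card (Cube k) := by
    intro h hh
    rw [Finset.mem_filter] at hh hh₁ ⊢
    refine ⟨Finset.mem_univ _, ?_⟩
    have h2 : (Finset.univ.filter fun u => bentFun h u ≠ bentFun h₁ u).card ≤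
        (Finset.univ.filter fun u => F u ≠ bentFun h u).card +
          (Finset.univ.filter fun u => F u ≠ bentFun h₁ u).card := by
      refine le_trans (Finset.card_le_card ?_) (Finset.card_union_le _ _)
      intro u
      simp only [Finset.mem_filter, Finset.mem_univ, true_and, Finset.mem_union]
      intro h3
      by_contra! h4
      exact h3 (h4.1.symm.trans h4.2)
    have h5 : ∀ u : Fin k ⊕ Fin k → ZMod 2, bentFun h u ≠ bentFun h₁ u ↔
        h (u ∘ Sum.inr) ≠ h₁ (u ∘ Sum.inr) := by
      intro u
      simp [bentFun]
    simp only [h5] at h2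
    have h6 := card_filter_comp_mul (A := ZMod 2) (Sum.inr_injective (α := Fin k) (β := Fin k))
      (fun y => h y ≠ h₁ y)
    simp only [ZMod.card, Fintype.card_fin, Fintype.card_sum] at h6
    have h7 := hh.2
    have h8 := hh₁.2
    simp only [Fintype.card_sum, Fintype.card_fin] at h7 h8
    have h9 : ((Finset.univ.filter fun u : Fin k ⊕ Fin k → ZMod 2 =>
        h (u ∘ Sum.inr) ≠ h₁ (u ∘ Sum.inr)).card : ℝ) ≤ 1 / 10 * 2 ^ (k + k) := by
      have : ((Finset.univ.filter fun u : Fin k ⊕ Fin k → ZMod 2 =>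
        h (u ∘ Sum.inr) ≠ h₁ (u ∘ Sum.inr)).card : ℝ) ≤
          (Finset.univ.filter fun u => F u ≠ bentFun h u).card +
            (Finset.univ.filter fun u => F u ≠ bentFun h₁ u).card := by exact_mod_cast h2
      linarith
    have h10 : 10 * (Finset.univ.filter fun u : Fin k ⊕ Fin k → ZMod 2 =>
        h (u ∘ Sum.inr) ≠ h₁ (u ∘ Sum.inr)).card ≤ 2 ^ (k + k) := by
      have : (10 : ℝ) * (Finset.univ.filter fun u : Fin k ⊕ Fin k → ZMod 2 =>
        h (u ∘ Sum.inr) ≠ h₁ (u ∘ Sum.inr)).card ≤ 2 ^ (k + k) := by linarith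
      exact_mod_cast this
    simp only [Fintype.card_fun, ZMod.card, Fintype.card_fin]
    have h11 : 0 < 2 ^ (k + k) := by positivity
    refine Nat.le_of_mul_le_mul_right ?_ h11
    rw [mul_assoc, ← h6, ← mul_assoc, mul_comm (2 ^ k)]
    exact Nat.mul_le_mul_right _ h10
  have h12 := card_hammingBall_sq_le h₁
  have h13 : 2 ^ Fintype.card (Cube k) = (2 ^ 2 ^ (k - 1)) ^ 2 := by
    obtain ⟨j, rfl⟩ : ∃ j, k = j + 1 := ⟨k - 1, by omega⟩
    simp only [Fintype.card_fun, ZMod.card, Fintype.card_fin, Nat.add_sub_cancel]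
    rw [← pow_mul, pow_succ]
  rw [h13] at h12
  exact (Finset.card_le_card hball).trans (le_of_pow_le_pow_left₀ (by norm_num) (by positivity) h12)

theorem card_linearDist_bentLift_lt_le {n k : ℕ} (hk : 1 ≤ k) {e : Fin k ⊕ Fin k → Fin n}
    (he : Function.Injective e) (h₀ : BoolFun k) [DecidablePred fun h : BoolFun k =>
      linearDist (bentLift e h₀) (bentLift e h) < 1 / 20] :
    (Finset.univ.filter fun h : BoolFun k =>
      linearDist (bentLift e h₀) (bentLift e h) < 1 / 20).card ≤
      2 ^ (4 * k ^ 2 + 2 * k + 2 ^ (k - 1)) := by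
  classical
  let T := Matrix (Fin k ⊕ Fin k) (Fin k ⊕ Fin k) (ZMod 2) × (Fin k ⊕ Fin k → ZMod 2)
  have h1 : (Finset.univ.filter fun h : BoolFun k =>
      linearDist (bentLift e h₀) (bentLift e h) < 1 / 20) ⊆
      (Finset.univ : Finset T).biUnion fun t => Finset.univ.filter fun h : BoolFun k =>
        ((Finset.univ.filter fun u => bentFun h₀ (t.1 *ᵥ u + t.2) ≠ bentFun h u).card : ℝ) <
          1 / 20 * 2 ^ Fintype.card (Fin k ⊕ Fin k) := by
    intro h hh
    obtain ⟨A, c, hAc⟩ := exists_affine_of_linearDist_lt he (bentFun h₀) (bentFun h)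
      (Finset.mem_filter.mp hh).2
    simp only [Finset.mem_biUnion, Finset.mem_filter, Finset.mem_univ, true_and]
    exact ⟨(A, c), hAc⟩
  refine (Finset.card_le_card h1).trans ((Finset.card_biUnion_le_card_mul _ _ _
    fun t _ => card_close_bentFun_le hk fun u => bentFun h₀ (t.1 *ᵥ u + t.2)).trans_eq ?_)
  have h2 : Fintype.card (Matrix (Fin k ⊕ Fin k) (Fin k ⊕ Fin k) (ZMod 2)) = 2 ^ (4 * k ^ 2) := by
    rw [Fintype.card_congr Matrix.of.symm, Fintype.card_fun, Fintype.card_fun]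
    simp only [ZMod.card, Fintype.card_sum, Fintype.card_fin]
    rw [← pow_mul]; congr 1; ring
  rw [Finset.card_univ, Fintype.card_prod, h2, Fintype.card_fun]
  simp only [ZMod.card, Fintype.card_sum, Fintype.card_fin]
  rw [← pow_add, ← pow_add, two_mul k]

/-- Greedy packing: a maximal set of pairwise distant points covers everything. -/
theorem exists_packing {α : Type*} [Fintype α] (close : α → α → Prop) [DecidableRel close]
    (hrefl : ∀ a, close a a) (hsymm : ∀ a b, close a b → close b a) {B : ℕ}
    (hB : ∀ a, (Finset.univ.filter (close a)).card ≤ B) :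
    ∃ S : Finset α, (∀ a ∈ S, ∀ b ∈ S, a ≠ b → ¬ close a b) ∧ Fintype.card α ≤ S.card * B := by
  classical
  obtain ⟨S, hS, hmax⟩ := Finset.exists_max_image
    (Finset.univ.filter fun S : Finset α => ∀ a ∈ S, ∀ b ∈ S, a ≠ b → ¬ close a b) Finset.card
    ⟨∅, by simp⟩
  have hS' := (Finset.mem_filter.mp hS).2
  refine ⟨S, hS', ?_⟩
  have hcover : (Finset.univ : Finset α) ⊆ S.biUnion fun a => Finset.univ.filter (close a) := by
    intro b _
    by_contra hb
    simp only [Finset.mem_biUnion, Finset.mem_filter, Finset.mem_univ, true_and, not_exists,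
      not_and] at hb
    have hbS : b ∉ S := fun h => hb b h (hrefl b)
    have h1 := hmax (insert b S) (by
      simp only [Finset.mem_filter, Finset.mem_univ, true_and, Finset.mem_insert]
      rintro a (rfl | ha) c (rfl | hc) hac
      · exact absurd rfl hac
      · exact fun h => hb c hc (hsymm _ _ h)
      · exact hb a ha
      · exact hS' a ha c hc hac)
    rw [Finset.card_insert_of_notMem hbS] at h1
    omega
  rw [← Finset.card_univ]
  exact (Finset.card_le_card hcover).trans (Finset.card_biUnion_le_card_mul _ _ _ fun a _ => hB a)

theorem exists_far_bentLifts {n k : ℕ} (hk : 1 ≤ k) {e : Fin k ⊕ Fin k → Fin n}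
    (he : Function.Injective e) :
    ∃ S : Finset (BoolFun k), 2 ^ 2 ^ (k - 1) ≤ S.card * 2 ^ (4 * k ^ 2 + 2 * k) ∧
      ∀ a ∈ S, ∀ b ∈ S, a ≠ b → 1 / 20 ≤ linearDist (bentLift e a) (bentLift e b) := by
  classical
  obtain ⟨S, hS, hcard⟩ := exists_packing
    (fun a b : BoolFun k => linearDist (bentLift e a) (bentLift e b) < 1 / 20)
    (fun a => by rw [linearDist_self]; norm_num) (fun a b h => by rwa [linearDist_comm])
    (fun a => card_linearDist_bentLift_lt_le hk he a)
  refine ⟨S, ?_, fun a ha b hb hab => not_lt.mp (hS a ha b hb hab)⟩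
  simp only [Fintype.card_fun, Fintype.card_units_int, ZMod.card, Fintype.card_fin] at hcard
  have h1 : 2 ^ k = 2 ^ (k - 1) + 2 ^ (k - 1) := by
    rw [← two_mul, ← pow_succ', Nat.sub_add_cancel hk]
  rw [h1, pow_add, pow_add _ _ (2 ^ (k - 1)), ← mul_assoc] at hcard
  exact Nat.le_of_mul_le_mul_right hcard (by positivity)

/-! ### Private-coin protocols of small cost -/

/-- The rectangle decomposition of a protocol: on inputs where at most `q` bits are exchanged,
acceptance is a sum over the `2 ^ q` possible transcripts of products of two indicators, one
depending on Alice's input and one on Bob's. -/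
theorem Protocol.exists_rectangle_decomposition {X Y : Type} (q : ℕ) (Q : Protocol X Y) :
    ∃ (u : (Fin q → Bool) → X → ℝ) (v : (Fin q → Bool) → Y → ℝ),
      (∀ i x, u i x ∈ Set.Icc 0 1) ∧ (∀ i y, v i y ∈ Set.Icc 0 1) ∧
      ∀ x y, Q.bits x y ≤ q → (if Q.run x y = true then (1 : ℝ) else 0) = ∑ i, u i x * v i y := by
  have h01 : ∀ (p : Prop) [Decidable p] (r : ℝ), r ∈ Set.Icc (0 : ℝ) 1 →
      (if p then r else 0) ∈ Set.Icc (0 : ℝ) 1 := by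
    intro p _ r hr
    split_ifs
    · exact hr
    · simp
  have hsum : ∀ (q : ℕ) (F : (Fin (q + 1) → Bool) → ℝ),
      ∑ i, F i = ∑ b : Bool, ∑ i : Fin q → Bool, F (Fin.cons b i) := by
    intro q F
    rw [← Fintype.sum_prod_type']
    exact ((Fin.consEquiv fun _ => Bool).sum_comp F).symm
  induction q generalizing Q with
  | zero =>
    cases Q with
    | output b =>
      refine ⟨fun _ _ => if b = true then 1 else 0, fun _ _ => 1, fun _ _ => h01 _ 1 (by simp),
        fun _ _ => by simp, fun x y _ => by cases b <;> simp [Protocol.run]⟩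
    | alice send next =>
      exact ⟨fun _ _ => 0, fun _ _ => 0, by simp, by simp,
        fun x y h => by simp [Protocol.bits] at h⟩
    | bob send next =>
      exact ⟨fun _ _ => 0, fun _ _ => 0, by simp, by simp,
        fun x y h => by simp [Protocol.bits] at h⟩
  | succ q ih =>
    cases Q with
    | output b =>
      -- The output is known at the start; the constant transcript is charged with it.
      refine ⟨fun i _ => if i = (fun _ => true) ∧ b = true then 1 else 0, fun _ _ => 1,
        fun _ _ => h01 _ 1 (by simp), fun _ _ => by simp, fun x y _ => ?_⟩
      by_cases hb : b = true <;> simp [Protocol.run, hb]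
    | alice send next =>
      choose u v hu hv huv using fun b => ih (next b)
      refine ⟨fun i x => if send x = i 0 then u (i 0) (Fin.tail i) x else 0,
        fun i y => v (i 0) (Fin.tail i) y, fun i x => h01 _ _ (hu _ _ _), fun i y => hv _ _ _,
        fun x y h => ?_⟩
      rw [Protocol.bits] at h
      rw [Protocol.run, huv _ x y (by omega), hsum]
      simp only [Fin.cons_zero, Fin.tail_cons]
      rw [Finset.sum_eq_single (send x)]
      · simp
      · intro b _ hb
        simp [hb.symm]
      · simp
    | bob send next =>
      choose u v hu hv huv using fun b => ih (next b)
      refine ⟨fun i x => u (i 0) (Fin.tail i) x,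
        fun i y => if send y = i 0 then v (i 0) (Fin.tail i) y else 0, fun i x => hu _ _ _,
        fun i y => h01 _ _ (hv _ _ _), fun x y h => ?_⟩
      rw [Protocol.bits] at h
      rw [Protocol.run, huv _ x y (by omega), hsum]
      simp only [Fin.cons_zero, Fin.tail_cons]
      rw [Finset.sum_eq_single (send y)]
      · simp
      · intro b _ hb
        simp [hb.symm]
      · simp

/-- The acceptance probability inherits the decomposition, since the coins of the two parties are
independent. -/
theorem PrivateCoinProtocol.exists_outputProb_decomposition {X Y : Type}
    (P : PrivateCoinProtocol X Y) (q : ℕ) :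
    ∃ (U : (Fin q → Bool) → X → ℝ) (V : (Fin q → Bool) → Y → ℝ),
      (∀ i x, U i x ∈ Set.Icc 0 1) ∧ (∀ i y, V i y ∈ Set.Icc 0 1) ∧
      ∀ x y, P.cost x y ≤ q → P.outputProb x y true = ∑ i, U i x * V i y := by
  obtain ⟨u, v, hu, hv, huv⟩ := P.tree.exists_rectangle_decomposition q
  have havg : ∀ {Z : Type} (a : ℕ) (F : Z → (Fin a → Bool) → ℝ), (∀ z r, F z r ∈ Set.Icc 0 1) →
      ∀ z, (∑ r, F z r) / 2 ^ a ∈ Set.Icc (0 : ℝ) 1 := by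
    intro Z a F hF z
    refine ⟨div_nonneg (Finset.sum_nonneg fun r _ => (hF z r).1) (by positivity), ?_⟩
    rw [div_le_one (by positivity)]
    refine (Finset.sum_le_card_nsmul _ _ 1 fun r _ => (hF z r).2).trans_eq (by simp)
  refine ⟨fun i x => (∑ r, u i (x, r)) / 2 ^ P.coinsA, fun i y => (∑ r, v i (y, r)) / 2 ^ P.coinsB,
    fun i => havg _ (fun x r => u i (x, r)) fun x r => hu i _,
    fun i => havg _ (fun y r => v i (y, r)) fun y r => hv i _, fun x y h => ?_⟩
  have h1 : ∀ r : P.Coins, P.tree.bits (x, r.1) (y, r.2) ≤ q := fun r =>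
    (Finset.le_sup (f := fun r : P.Coins => P.tree.bits (x, r.1) (y, r.2))
      (Finset.mem_univ r)).trans h
  rw [outputProb, Finset.natCast_card_filter,
    Finset.sum_congr rfl fun r _ => huv (x, r.1) (y, r.2) (h1 r), Finset.sum_comm, Finset.sum_div]
  refine Finset.sum_congr rfl fun i _ => ?_
  rw [Fintype.sum_prod_type]
  dsimp only
  rw [← Finset.sum_mul_sum]
  simp only [Coins, Fintype.card_prod, Fintype.card_fun, Fintype.card_bool, Fintype.card_fin]
  push_cast
  exact mul_div_mul_comm _ _ _ _

/-- A private-coin protocol that tells equal from distinct elements of a set with more than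
`2 ^ 2 ^ (2 * q + 2)` elements exchanges more than `q` bits on some pair of elements. Otherwise
two distinct elements have nearly the same vector of transcript probabilities on Alice's side, so
that they are accepted with nearly the same probability against any input of Bob. -/
theorem PrivateCoinProtocol.exists_lt_cost {X : Type} (P : PrivateCoinProtocol X X) {q : ℕ}
    (S : Finset X) (hS : 2 ^ 2 ^ (2 * q + 2) < S.card)
    (heq : ∀ x ∈ S, 2 / 3 ≤ P.outputProb x x true)
    (hne : ∀ x ∈ S, ∀ y ∈ S, x ≠ y → 2 / 3 ≤ P.outputProb x y false) :
    ∃ x ∈ S, ∃ y ∈ S, q < P.cost x y := by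
  by_contra! H
  obtain ⟨U, V, hU, hV, hUV⟩ := P.exists_outputProb_decomposition q
  let round : X → (Fin q → Bool) → Fin (2 ^ (q + 2) + 1) := fun x i =>
    ⟨⌊U i x * 2 ^ (q + 2)⌋₊, by
      refine Nat.lt_succ_of_le (Nat.floor_le_of_le ?_)
      push_cast
      exact mul_le_of_le_one_left (by positivity) (hU i x).2⟩
  have hcard : (Finset.univ : Finset ((Fin q → Bool) → Fin (2 ^ (q + 2) + 1))).card < S.card := by
    refine lt_of_le_of_lt ?_ hS
    rw [Finset.card_univ, Fintype.card_fun, Fintype.card_fun]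
    simp only [Fintype.card_fin, Fintype.card_bool]
    calc (2 ^ (q + 2) + 1) ^ 2 ^ q ≤ (2 ^ (q + 3)) ^ 2 ^ q := by
          refine Nat.pow_le_pow_left ?_ _
          have := Nat.one_le_two_pow (n := q + 2)
          rw [pow_succ 2 (q + 2)]
          omega
      _ = 2 ^ ((q + 3) * 2 ^ q) := (pow_mul _ _ _).symm
      _ ≤ 2 ^ 2 ^ (2 * q + 2) := by
          refine Nat.pow_le_pow_right (by norm_num) ?_
          rw [show 2 * q + 2 = q + 2 + q by ring, pow_add 2 (q + 2)]
          exact Nat.mul_le_mul_right _ (Nat.lt_two_pow_self (n := q + 2))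
  obtain ⟨x, hx, x', hx', hxx', hround⟩ := Finset.exists_ne_map_eq_of_card_lt_of_maps_to hcard
    (f := round) (fun _ _ => Finset.mem_univ _)
  have hclose : ∀ i, U i x' - U i x ≤ 1 / 2 ^ (q + 2) := by
    intro i
    have h1 : ⌊U i x * 2 ^ (q + 2)⌋₊ = ⌊U i x' * 2 ^ (q + 2)⌋₊ :=
      congrArg Fin.val (congrFun hround i)
    have h2 := Nat.floor_le (mul_nonneg (hU i x).1 (by positivity : (0 : ℝ) ≤ 2 ^ (q + 2)))
    have h3 := Nat.lt_floor_add_one (U i x' * 2 ^ (q + 2))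
    rw [h1] at h2
    rw [le_div_iff₀ (by positivity)]
    linarith
  have h4 : P.outputProb x' x' true - P.outputProb x x' true ≤ 1 / 4 := by
    rw [hUV _ _ (H x' hx' x' hx'), hUV _ _ (H x hx x' hx'), ← Finset.sum_sub_distrib]
    refine (Finset.sum_le_card_nsmul _ _ (1 / 2 ^ (q + 2)) fun i _ => ?_).trans_eq ?_
    · rw [← sub_mul]
      have h5 : (0 : ℝ) ≤ 1 / 2 ^ (q + 2) := by positivity
      have h6 := hV i x'
      have h7 := hclose i
      nlinarith [h6.1, h6.2]
    · simp only [Finset.card_univ, Fintype.card_fun, Fintype.card_bool, Fintype.card_fin,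
        nsmul_eq_mul, Nat.cast_pow, Nat.cast_ofNat, pow_add]
      field_simp
      norm_num
  have h6 := heq x' hx'
  have h7 := hne x hx x' hx' hxx'
  have h8 := P.outputProb_true_add_false x x'
  linarith

/-- A protocol that exchanges no bits on some pair of inputs has a constant output. -/
theorem PrivateCoinProtocol.exists_outputProb_eq_one_of_cost_eq_zero {X Y : Type}
    (P : PrivateCoinProtocol X Y) {x₀ : X} {y₀ : Y} (h : P.cost x₀ y₀ = 0) :
    ∃ b, ∀ x y, P.outputProb x y b = 1 := by
  have h1 : P.tree.bits (x₀, default) (y₀, default) = 0 := by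
    refine Nat.le_zero.mp (h ▸ Finset.le_sup (f := fun r : P.Coins =>
      P.tree.bits (x₀, r.1) (y₀, r.2)) (Finset.mem_univ (default, default)))
  obtain ⟨a, c, tree⟩ := P
  cases tree with
  | output b => exact ⟨b, fun x y => by simp [outputProb, Protocol.run]⟩
  | alice send next => simp [Protocol.bits] at h1
  | bob send next => simp [Protocol.bits] at h1

/-! ### The lower bound -/

theorem linearDist_one_neg_one (n : ℕ) : linearDist (1 : BoolFun n) (-1) = 1 := by
  obtain ⟨e, he⟩ := exists_linearDist_eq (1 : BoolFun n) (-1)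
  have h1 : ∀ x, ((1 : BoolFun n) ∘ e) x ≠ (-1 : BoolFun n) x := fun x => by
    simp only [Function.comp_apply, Pi.one_apply, Pi.neg_apply]
    decide
  rw [he, hammingDelta, Finset.filter_true_of_mem fun x _ => h1 x]
  simp [ZMod.card]

/-- A deciding protocol exchanges at least one bit on every pair of inputs. -/
theorem one_le_cost_of_decidesLinIso {n : ℕ} {P : PrivateCoinProtocol (BoolFun n) (BoolFun n)}
    {ω : ℝ} (hω : ω ≤ 1) (hP : DecidesLinIso P ω) (f g : BoolFun n) : 1 ≤ P.cost f g := by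
  by_contra! h
  obtain ⟨b, hb⟩ := P.exists_outputProb_eq_one_of_cost_eq_zero (Nat.lt_one_iff.mp h)
  cases b with
  | true =>
    have h1 := (hP 1 (-1)).2 (by rwa [linearDist_one_neg_one])
    have h2 := P.outputProb_true_add_false 1 (-1)
    rw [hb] at h2
    linarith
  | false =>
    have h1 := (hP 1 1).1 (linearDist_self 1)
    have h2 := P.outputProb_true_add_false 1 1
    rw [hb] at h2
    linarith

/-- Within the bent family, a deciding protocol has cost at least logarithmic in the size of the
largest subfamily of pairwise distant members, hence linear in `k`. -/
theorem exists_bentLift_lt_cost {n k : ℕ} (hk : 20 ≤ k) {e : Fin k ⊕ Fin k → Fin n}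
    (he : Function.Injective e) {P : PrivateCoinProtocol (BoolFun n) (BoolFun n)}
    (hP : DecidesLinIso P (1 / 20)) :
    ∃ a b : BoolFun k, (linearDist (bentLift e a) (bentLift e b) = 0 ∨
      1 / 20 ≤ linearDist (bentLift e a) (bentLift e b)) ∧
      k / 10 < P.cost (bentLift e a) (bentLift e b) := by
  classical
  obtain ⟨S, hS, hfar⟩ := exists_far_bentLifts (by omega : 1 ≤ k) he
  have hinj : Set.InjOn (bentLift e) (S : Set (BoolFun k)) := by
    intro a ha b hb hab
    by_contra hne
    have := hfar a ha b hb hne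
    rw [hab, linearDist_self] at this
    norm_num at this
  have hcard : 2 ^ 2 ^ (2 * (k / 10) + 2) < (S.image (bentLift e)).card := by
    rw [Finset.card_image_of_injOn hinj]
    by_contra! h
    have h1 := hS.trans (Nat.mul_le_mul_right _ h)
    rw [← pow_add, Nat.pow_le_pow_iff_right (by norm_num)] at h1
    have h2 : 2 ^ (2 * (k / 10) + 2) ≤ 2 ^ (k - 3) := Nat.pow_le_pow_right (by norm_num) (by omega)
    have h3 : 4 * k ^ 2 + 2 * k < 2 ^ (k - 3) := by
      clear * - hk
      induction k, hk using Nat.le_induction with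
      | base => norm_num
      | succ k hk ih =>
        rw [show k + 1 - 3 = k - 3 + 1 by omega, pow_succ 2 (k - 3)]
        nlinarith
    have h4 : 2 ^ (k - 1) = 2 ^ (k - 3) * 4 := by
      rw [show k - 1 = k - 3 + 2 by omega, pow_add]; norm_num
    omega
  obtain ⟨f, hf, g, hg, hfg⟩ := P.exists_lt_cost (S.image (bentLift e)) hcard
    (fun f _ => (hP f f).1 (linearDist_self f)) (by
      intro f hf g hg hne
      obtain ⟨a, ha, rfl⟩ := Finset.mem_image.mp hf
      obtain ⟨b, hb, rfl⟩ := Finset.mem_image.mp hg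
      exact (hP _ _).2 (hfar a ha b hb fun h => hne (h ▸ rfl)))
  obtain ⟨a, ha, rfl⟩ := Finset.mem_image.mp hf
  obtain ⟨b, hb, rfl⟩ := Finset.mem_image.mp hg
  refine ⟨a, b, ?_, hfg⟩
  by_cases hab : a = b
  · exact Or.inl (hab ▸ linearDist_self _)
  · exact Or.inr (hfar a ha b hb hab)

theorem specParam_bentLift_bounds {n k T : ℕ} {e : Fin k ⊕ Fin k → Fin n}
    (he : Function.Injective e) (h1 : 2 ^ k ≤ T) (h2 : T < 2 ^ (k + 1)) (a b : BoolFun k) :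
    (T : ℝ) ^ (1 / 100 : ℝ) ≤ specParam (bentLift e a) (bentLift e b) ∧
      specParam (bentLift e a) (bentLift e b) ≤ T := by
  have key : ∀ a : BoolFun k, (T : ℝ) ^ (1 / 100 : ℝ) ≤ specCeil (bentLift e a) := by
    intro a
    set s := specCeil (bentLift e a) with hs
    have h3 : (2 : ℝ) ^ (k + 1) ≤ 3 * s := by
      have := le_specCeil_bentLift he a
      rw [pow_succ]
      linarith
    have h4 : 2 ^ (k + 1) ≤ 3 * s := by exact_mod_cast h3
    have h5 : 1 ≤ s := one_le_specCeil _
    have h6 : T ≤ s ^ 100 := by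
      rcases Nat.eq_zero_or_pos k with rfl | hk
      · exact (by omega : T ≤ 1).trans (Nat.one_le_pow _ _ h5)
      · have h7 : 2 ^ (1 + 1) ≤ 2 ^ (k + 1) := Nat.pow_le_pow_right (by norm_num) (by omega)
        calc T ≤ 3 * s := by omega
          _ ≤ 2 ^ 99 * s := Nat.mul_le_mul_right _ (by norm_num)
          _ ≤ s ^ 99 * s := Nat.mul_le_mul_right _ (Nat.pow_le_pow_left (by omega) _)
          _ = s ^ 100 := (pow_succ _ _).symm
    rw [one_div, Real.rpow_inv_le_iff_of_pos (by positivity) (by positivity) (by norm_num)]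
    exact_mod_cast h6
  rw [specParam_eq_min]
  refine ⟨?_, (min_le_left _ _).trans ((specCeil_bentLift_le he a).trans h1)⟩
  push_cast
  exact le_min (key a) (key b)

theorem exists_cost_ge_log {n T : ℕ} (hT : 1 ≤ T) (hTn : T ^ 2 ≤ 2 ^ n)
    {P : PrivateCoinProtocol (BoolFun n) (BoolFun n)} (hP : DecidesLinIso P (1 / 20)) :
    ∃ f g : BoolFun n, (linearDist f g = 0 ∨ 1 / 20 ≤ linearDist f g) ∧
      (T : ℝ) ^ (1 / 100 : ℝ) ≤ (specParam f g : ℝ) ∧ specParam f g ≤ T ∧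
      1 / 100 * Real.log (T : ℝ) ≤ (P.cost f g : ℝ) := by
  set k := Nat.log 2 T with hk
  have h1 : 2 ^ k ≤ T := Nat.pow_log_le_self 2 (by omega)
  have h2 : T < 2 ^ (k + 1) := Nat.lt_pow_succ_log_self (by norm_num) T
  have hkn : k + k ≤ n := by
    have h3 : 2 ^ (k + k) ≤ 2 ^ n := by
      rw [pow_add, ← sq]
      exact (Nat.pow_le_pow_left h1 2).trans hTn
    exact (Nat.pow_le_pow_iff_right (by norm_num)).mp h3
  have he : Function.Injective (Fin.castLE hkn ∘ finSumFinEquiv) :=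
    (Fin.castLE_injective hkn).comp finSumFinEquiv.injective
  have hlog : Real.log T ≤ k + 1 := by
    have hT0 : (0 : ℝ) < T := by exact_mod_cast hT
    have h3 : (T : ℝ) ≤ 2 ^ (k + 1) := by exact_mod_cast h2.le
    have h4 := Real.log_le_log hT0 h3
    rw [Real.log_pow] at h4
    have h5 := Real.log_two_lt_d9
    push_cast at h4
    nlinarith
  rcases lt_or_ge k 20 with hk20 | hk20
  · obtain ⟨h3, h4⟩ := specParam_bentLift_bounds he h1 h2 1 1
    refine ⟨_, _, Or.inl (linearDist_self _), h3, h4, ?_⟩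
    have h5 : (1 : ℝ) ≤ P.cost (bentLift (Fin.castLE hkn ∘ finSumFinEquiv) 1)
        (bentLift (Fin.castLE hkn ∘ finSumFinEquiv) 1) := by
      exact_mod_cast one_le_cost_of_decidesLinIso (by norm_num) hP _ _
    have h6 : (k : ℝ) ≤ 20 := by exact_mod_cast hk20.le
    linarith
  · obtain ⟨a, b, hab, hcost⟩ := exists_bentLift_lt_cost hk20 he hP
    obtain ⟨h3, h4⟩ := specParam_bentLift_bounds he h1 h2 a b
    refine ⟨_, _, hab, h3, h4, ?_⟩
    have h5 : k + 1 ≤ 100 * P.cost (bentLift (Fin.castLE hkn ∘ finSumFinEquiv) a)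
        (bentLift (Fin.castLE hkn ∘ finSumFinEquiv) b) := by omega
    have h6 : (k : ℝ) + 1 ≤ 100 * P.cost (bentLift (Fin.castLE hkn ∘ finSumFinEquiv) a)
        (bentLift (Fin.castLE hkn ∘ finSumFinEquiv) b) := by exact_mod_cast h5
    linarith

theorem theorem2 :
    (∃ C : ℝ, 0 < C ∧ ∀ (n : ℕ) (ω : ℝ), 0 < ω →
      ∃ P : PrivateCoinProtocol (BoolFun n) (BoolFun n),
        DecidesLinIso P ω ∧
        ∀ f g : BoolFun n, (P.cost f g : ℝ) ≤ C * ((specParam f g : ℝ) ^ 2 / ω ^ 3)) ∧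
    (∃ c : ℝ, 0 < c ∧ ∀ n T : ℕ, 1 ≤ T → T ^ 2 ≤ 2 ^ n →
      ∀ P : PrivateCoinProtocol (BoolFun n) (BoolFun n),
        DecidesLinIso P (1 / 20) →
        ∃ f g : BoolFun n,
          (linearDist f g = 0 ∨ 1 / 20 ≤ linearDist f g) ∧
          (T : ℝ) ^ c ≤ (specParam f g : ℝ) ∧ specParam f g ≤ T ∧
          c * Real.log (T : ℝ) ≤ (P.cost f g : ℝ)) :=
  ⟨⟨53, by norm_num, fun _ _ hω => exists_protocol_decidesLinIso hω⟩,
    ⟨1 / 100, by norm_num, fun _ _ hT hTn _ hP => exists_cost_ge_log hT hTn hP⟩⟩
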